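/- Let $(\mathcal X,\omega)$ be a Kähler manifold of complex dimension $n+1$ with Hermitian scalar product $\langle\cdot,\cdot\rangle$ ($\omega=i\,h_{j\bar k}\,dz^j\wedge d\bar z^k$, $\langle\partial_j,\partial_{\bar k}\rangle=h_{j\bar k}$, extended to a symmetric complex bilinear form on $\mathbb C T\mathcal X$), and let $\iota\colon M\to\mathcal X$ be a smoothly immersed real hypersurface with the induced CR structure $T^{1,0}M$. Let $\theta$ be a smooth real 1-form on $M$ with kernel $\mathrm{Re}\,T^{1,0}M$ and $d\theta=\iota^*\omega$. Let $T$ be the Reeb field ($\theta(T)=1$, $d\theta(T,\cdot)=0$), let $\nabla$ be the Tanaka–Webster connection of $(M,\theta)$, with curvature $R(X,Y)=\nabla_X\nabla_Y-\nabla_Y\nabla_X-\nabla_{[X,Y]}$ and pseudohermitian torsion $\tau X=\nabla_TX-\nabla_XT-[T,X]$, and let $\widetilde\nabla$ be the Chern connection of $\omega$, with curvature $\widetilde R$ (same sign convention). Put $\mathrm{II}(Z,W)=\widetilde\nabla_ZW-\nabla_ZW$ and $H=\frac1n\sum_{\alpha=1}^n\mathrm{II}(Z_{\bar\alpha},Z_\alpha)$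 for a unitary basis $Z_1,\dots,Z_n$ of $T^{1,0}M$ with respect to the Levi metric $\langle Z,\overline W\rangle=-i\,d\theta(Z,\overline W)$. For $0\ne Z\in T^{1,0}M$ put $$K(Z)=\frac12\,\frac{\langle R(Z,\overline Z)Z,\overline Z\rangle}{|Z|^4},\qquad \tilde K(Z)=\frac{\langle \widetilde R(Z,\overline Z)Z,\overline Z\rangle}{|Z|^4},\qquad A(Z)=\frac{i\,\langle\tau Z,Z\rangle}{|Z|^2}.$$ Then for every $0\neq Z\in T^{1,0}M$ one has $|H|^2>0$ at the base point of $Z$ and $$K(Z)+\frac12\,\frac{|A(Z)|^2}{|H|^2}=\frac12\,\tilde K(Z)+|H|^2 .$$ Moreover, the pseudohermitian torsion $\tau$ vanishes identically on $M$ if and only if $\iota$ is totally umbilical, that is, $\mathrm{II}(Z,W)=0$ for all $(1,0)$-vectors $Z,W$ at every point of $M$. In this case, $K(Z)=\frac12\tilde K(Z)+|H|^2$ for every $0\neq Z\in T^{1,0}M$. -/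

import Mathlib

open scoped Manifold ContDiff Topology

noncomputable section

namespace SemiIsometric

/-- Holomorphic coordinates on the ambient complex manifold (complex dimension `n + 1`). A vector
`w : EE n` also stands for the `(1,0)`-vector `∑ j, w j • ∂/∂z_j`; the real tangent vector
with the same coordinates is twice the real part of this `(1,0)`-vector. -/
abbrev EE (n : ℕ) : Type := EuclideanSpace ℂ (Fin (n + 1))

/-- Real coordinates on the hypersurface (real dimension `2 n + 1`). -/
abbrev VV (n : ℕ) : Type := EuclideanSpace ℝ (Fin (2 * n + 1))

/-- The complexification of `VV n`: `Z : VC n` stands for `∑ a, Z a • ∂/∂x_a`. -/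
abbrev VC (n : ℕ) : Type := EuclideanSpace ℂ (Fin (2 * n + 1))

/-- Coordinatewise complex conjugation. -/
def conjVec {k : ℕ} (z : EuclideanSpace ℂ (Fin k)) : EuclideanSpace ℂ (Fin k) :=
  WithLp.toLp 2 fun a => starRingEnd ℂ (z a)

/-- Coordinatewise real part. -/
def reVec {k : ℕ} (z : EuclideanSpace ℂ (Fin k)) : EuclideanSpace ℝ (Fin k) :=
  WithLp.toLp 2 fun a => (z a).re

/-- A real vector seen as a complex one. -/
def ofRealVec {k : ℕ} (v : EuclideanSpace ℝ (Fin k)) : EuclideanSpace ℂ (Fin k) :=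
  WithLp.toLp 2 fun a => (v a : ℂ)

/-- The coordinate vector `∂/∂x_a`. -/
def coordVec {n : ℕ} (a : Fin (2 * n + 1)) : VV n := EuclideanSpace.single a 1

/-! ### Hermitian metrics in holomorphic coordinates

`h z v w` is the Hermitian form `∑ h_{j k̄}(z) v_j (conj w_k)`, i.e. the scalar product of
`∑ v_j ∂_j` with the conjugate of `∑ w_k ∂_k`. -/

section Ambient

variable {n : ℕ}

/-- The derivative `v(f) = ∑ v_j ∂f/∂z_j`. -/
def dHol {G : Type*} [NormedAddCommGroup G] [NormedSpace ℂ G]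
    (v : EE n) (f : EE n → G) (z : EE n) : G :=
  (1 / 2 : ℂ) • (fderiv ℝ f z v - Complex.I • fderiv ℝ f z (Complex.I • v))

/-- The derivative `v̄(f) = ∑ (conj v_j) ∂f/∂z̄_j`. -/
def dAnti {G : Type*} [NormedAddCommGroup G] [NormedSpace ℂ G]
    (v : EE n) (f : EE n → G) (z : EE n) : G :=
  (1 / 2 : ℂ) • (fderiv ℝ f z v + Complex.I • fderiv ℝ f z (Complex.I • v))

/-- The fundamental form `ω = i ∑ h_{j k̄} dz_j ∧ dz̄_k`, on real vectors:
`ω(v,w) = i (h(v,w) - h(w,v)) = -2 Im h(v,w)`. -/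
def fundForm (h : EE n → EE n → EE n → ℂ) (z v w : EE n) : ℝ := -2 * (h z v w).im

/-- The Christoffel symbol of the Chern connection: `∇̃_v w = Γ(v,w)` for the coordinate
`(1,0)`-fields `v`, `w`. Since `∇̃_v̄ w = 0`, compatibility with the metric says that
`⟨Γ(v,w), ȳ⟩ = v ⟨w, ȳ⟩` for all coordinate fields `y`. -/
def chernSymbol (h : EE n → EE n → EE n → ℂ) (z v w : EE n) : EE n :=
  Classical.epsilon fun γ => ∀ y : EE n, h z γ y = dHol v (fun z' => h z' w y) z

/-- The curvature of the Chern connection, for coordinate fields: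
`R̃(v, w̄) y = ∇̃_v ∇̃_w̄ y - ∇̃_w̄ ∇̃_v y = - w̄ (Γ(v,y))`. -/
def chernCurv (h : EE n → EE n → EE n → ℂ) (z v w y : EE n) : EE n :=
  - dAnti w (fun z' => chernSymbol h z' v y) z

/-- The holomorphic sectional curvature `⟨R̃(w,w̄)w, w̄⟩ / |w|⁴`. -/
def chernHolSec (h : EE n → EE n → EE n → ℂ) (z w : EE n) : ℂ :=
  h z (chernCurv h z w w w) w / (h z w w) ^ 2

end Ambient

/-- The coordinate expressions of an immersion `F`, of a real 1-form `θ` on the source and of a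
Hermitian metric `h` on the target. -/
structure LocalData (n : ℕ) where
  F : VV n → EE n
  θ : VV n → VV n → ℝ
  h : EE n → EE n → EE n → ℂ

/-- The derivative `Z(f) = ∑ Z_a ∂f/∂x_a` along a complex tangent vector. -/
def dirD {n : ℕ} {G : Type*} [NormedAddCommGroup G] [NormedSpace ℂ G]
    (Z : VC n) (f : VV n → G) (u : VV n) : G :=
  ∑ a, Z a • fderiv ℝ f u (coordVec a)

/-- The Lie bracket of complex vector fields. -/
def bracket {n : ℕ} (Z W : VV n → VC n) (u : VV n) : VC n :=
  dirD (Z u) W u - dirD (W u) Z u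

namespace LocalData

variable {n : ℕ} (d : LocalData n)

/-! ### The pseudohermitian structure -/

/-- `θ` on complex vectors. -/
def thetaC (u : VV n) (Z : VC n) : ℂ := ∑ a, Z a * (d.θ u (coordVec a) : ℂ)

/-- `dθ` on real vectors. -/
def dTheta (u v w : VV n) : ℝ :=
  fderiv ℝ (fun u' => d.θ u' w) u v - fderiv ℝ (fun u' => d.θ u' v) u w

/-- `dθ` on complex vectors. -/
def dThetaC (u : VV n) (Z W : VC n) : ℂ :=
  ∑ a, ∑ b, Z a * W b * (d.dTheta u (coordVec a) (coordVec b) : ℂ)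

/-- The `(1,0)`-part of the image of a complex tangent vector under the differential of `F`. -/
def push (u : VV n) (Z : VC n) : EE n := dirD Z d.F u

/-- `Z ∈ T^{1,0}M`: the image of `Z` under the differential of `F` is of type `(1,0)`, i.e. its
coefficients `Z(conj F_j)` along `∂/∂z̄_j` vanish. -/
def IsT10 (u : VV n) (Z : VC n) : Prop := dirD Z (fun u' => conjVec (d.F u')) u = 0

/-- `⟨Z, W̄⟩ = -i dθ(Z, W̄)`, the Levi metric, for `Z, W ∈ T^{1,0}M`. -/
def levi (u : VV n) (Z W : VC n) : ℂ := -Complex.I * d.dThetaC u Z (conjVec W)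

/-- The Reeb field: `θ(T) = 1` and `dθ(T, ·) = 0`. -/
def reeb (u : VV n) : VV n :=
  Classical.epsilon fun T => d.θ u T = 1 ∧ ∀ v, d.dTheta u T v = 0

/-- The Reeb field as a complex field. -/
def reebC (u : VV n) : VC n := ofRealVec (d.reeb u)

/-- The projection onto `T^{1,0}M` in `ℂTM = T^{1,0}M ⊕ T^{0,1}M ⊕ ℂT`. -/
def proj10 (u : VV n) (Y : VC n) : VC n :=
  Classical.epsilon fun Z => d.IsT10 u Z ∧
    d.IsT10 u (conjVec (Y - Z - d.thetaC u Y • d.reebC u))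

/-- `W` is a smooth section of `T^{1,0}M` near `u`. -/
def IsSection (W : VV n → VC n) (u : VV n) : Prop :=
  ∀ᶠ u' in 𝓝 u, ContDiffAt ℝ ∞ W u' ∧ d.IsT10 u' (W u')

/-- At `u`, the map `F` is an immersion, the kernel of `θ` is `H(M) = Re T^{1,0}M`, and
`dθ = F^* ω`. (Then `dθ` is positive definite on `H(M)` since `ω` is the fundamental form of a
positive definite metric: strict pseudoconvexity need not be required separately.) -/
structure IsSemiIsometricAt (u : VV n) : Prop where
  immersion : Function.Injective (fderiv ℝ d.F u)
  contact : ∀ v : VV n, d.θ u v = 0 ↔ ∃ Z : VC n, d.IsT10 u Z ∧ reVec Z = v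
  semi_isometric : ∀ v w : VV n,
    d.dTheta u v w = fundForm d.h (d.F u) (fderiv ℝ d.F u v) (fderiv ℝ d.F u w)

/-! ### The Tanaka-Webster connection

For sections `W`, `V` of `T^{1,0}M` the structure equations
`dθ^β = θ^α ∧ ω_α^β + A^β_ᾱ θ ∧ θ^ᾱ` say, when evaluated on pairs of frame vectors, that
`∇_Z̄ W = π_{1,0}[Z̄, W]` and `∇_T W = π_{1,0}[T, W]`; the equation for `dh_{α β̄}` is
`Z⟨W, V̄⟩ = ⟨∇_Z W, V̄⟩ + ⟨W, ∇_Z V̄⟩`, where `∇_Z V̄` is the conjugate of `∇_Z̄ V`. -/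

/-- `∇_Z W` for `(1,0)`-fields `Z` and `W`. -/
def nabla10 (Z W : VV n → VC n) (u : VV n) : VC n :=
  Classical.epsilon fun Y => d.IsT10 u Y ∧ ∀ V : VV n → VC n, d.IsSection V u →
    dirD (Z u) (fun u' => d.levi u' (W u') (V u')) u
      = d.levi u Y (V u)
        + d.levi u (W u) (d.proj10 u (bracket (fun u' => conjVec (Z u')) V u))

/-- The Tanaka-Webster derivative `∇_Y W` of a `(1,0)`-field `W` in the direction of an arbitrary
complex field `Y = π_{1,0}Y + (Y - π_{1,0}Y)`, whose second part is a section of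
`T^{0,1}M ⊕ ℂT`. -/
def nabla (Y W : VV n → VC n) (u : VV n) : VC n :=
  d.nabla10 (fun u' => d.proj10 u' (Y u')) W u
    + d.proj10 u (bracket (fun u' => Y u' - d.proj10 u' (Y u')) W u)

/-- The curvature operator `R(Y₁,Y₂)W = ∇_{Y₁}∇_{Y₂}W - ∇_{Y₂}∇_{Y₁}W - ∇_{[Y₁,Y₂]}W`. -/
def curv (Y₁ Y₂ W : VV n → VC n) (u : VV n) : VC n :=
  d.nabla Y₁ (d.nabla Y₂ W) u - d.nabla Y₂ (d.nabla Y₁ W) u - d.nabla (bracket Y₁ Y₂) W u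

/-- The pseudohermitian torsion `τW = ∇_T W - ∇_W T - [T, W]`, where `∇T = 0`. -/
def tau (W : VV n → VC n) (u : VV n) : VC n :=
  d.nabla d.reebC W u - bracket d.reebC W u

/-! ### The second fundamental form -/

/-- The Chern derivative `∇̃_Y W` of a `(1,0)`-field `W` along the hypersurface, in the ambient
holomorphic coordinates: `Y(W_k) + ∑ Γ^k_{ij} Y_i W_j`. -/
def chernNabla (Y W : VV n → VC n) (u : VV n) : EE n :=
  dirD (Y u) (fun u' => d.push u' (W u')) u
    + chernSymbol d.h (d.F u) (d.push u (Y u)) (d.push u (W u))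

/-- The second fundamental form `II(Y,W) = ∇̃_Y W - ∇_Y W`, for a `(1,0)`-field `W`. -/
def secondFF (Y W : VV n → VC n) (u : VV n) : EE n :=
  d.chernNabla Y W u - d.push u (d.nabla Y W u)

/-! ### Values at a point

The expressions above that are tensorial are evaluated on vectors at a point by extending a
`(1,0)`-vector to a `(1,0)`-field. -/

/-- An extension of a `(1,0)`-vector to a section of `T^{1,0}M`. -/
def extend (z : VC n) (u : VV n) : VC n := d.proj10 u z

/-- The conjugate of `extend z`. -/
def extendBar (z : VC n) (u : VV n) : VC n := conjVec (d.proj10 u z)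

/-- The pseudohermitian torsion at `u`. -/
def tauAt (u : VV n) (z : VC n) : VC n := d.tau (d.extend z) u

/-- The second fundamental form on `(1,0)`-vectors at `u`. -/
def secondFFAt (u : VV n) (z w : VC n) : EE n := d.secondFF (d.extend z) (d.extend w) u

/-- `II(z̄, w)` for `(1,0)`-vectors `z`, `w` at `u`. -/
def secondFFBarAt (u : VV n) (z w : VC n) : EE n := d.secondFF (d.extendBar z) (d.extend w) u

/-- A unitary basis of `T^{1,0}M` at `u`: `n` orthonormal vectors (`n` is the dimension). -/
def IsUnitaryBasis (u : VV n) (e : Fin n → VC n) : Prop :=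
  (∀ α, d.IsT10 u (e α)) ∧ ∀ α β, d.levi u (e α) (e β) = if α = β then 1 else 0

/-- A unitary basis of `T^{1,0}M` at `u`. -/
def unitaryBasis (u : VV n) : Fin n → VC n := Classical.epsilon (d.IsUnitaryBasis u)

/-- The `(1,0)`-mean curvature vector `H = (1/n) ∑ II(Z_ᾱ, Z_α)`, for a unitary basis `Z_α`. -/
def meanCurv (u : VV n) : EE n :=
  (1 / (n : ℂ)) • ∑ α, d.secondFFBarAt u (d.unitaryBasis u α) (d.unitaryBasis u α)

/-- `|H|²`. -/
def meanCurvSq (u : VV n) : ℝ := (d.h (d.F u) (d.meanCurv u) (d.meanCurv u)).re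

/-- The Tanaka-Webster holomorphic sectional curvature `(1/2) ⟨R(z,z̄)z, z̄⟩ / |z|⁴`. -/
def holSec (u : VV n) (z : VC n) : ℂ :=
  (1 / 2) * d.levi u (d.curv (d.extend z) (d.extendBar z) (d.extend z) u) z / (d.levi u z z) ^ 2

/-- The holomorphic sectional torsion `i A_{αβ} ζ^α ζ^β / |z|² = i ⟨τz, z⟩ / |z|²`. As `τz` is of
type `(0,1)` and `⟨·,·⟩` is the symmetric complex bilinear form, `⟨τz, z⟩` is the Levi product of
`z` and the `(1,0)`-vector conjugate to `τz`. -/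
def holTor (u : VV n) (z : VC n) : ℂ :=
  Complex.I * d.levi u z (conjVec (d.tauAt u z)) / d.levi u z z

/-- The holomorphic sectional curvature of the ambient metric, on the image of `z`. -/
def ambientHolSec (u : VV n) (z : VC n) : ℂ := chernHolSec d.h (d.F u) (d.push u z)

end LocalData

/-! ### Kähler manifolds, real 1-forms, and hypersurfaces -/

section Global

variable {n : ℕ}
  {X : Type*} [TopologicalSpace X] [ChartedSpace (EE n) X]
  {M : Type*} [TopologicalSpace M] [ChartedSpace (VV n) M]

/-- A sesquilinear form on each (complex) tangent space. -/
abbrev SesqField (n : ℕ) (X : Type*) [TopologicalSpace X] [ChartedSpace (EE n) X] : Type _ :=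
  ∀ x : X, TangentSpace 𝓘(ℂ, EE n) x →ₗ[ℂ] TangentSpace 𝓘(ℂ, EE n) x →ₛₗ[starRingEnd ℂ] ℂ

/-- The expression of a field of sesquilinear forms in the holomorphic chart at `x`. -/
def SesqField.inChart (g : SesqField n X) (x : X) (z v w : EE n) : ℂ :=
  g ((extChartAt 𝓘(ℂ, EE n) x).symm z)
    (mfderiv 𝓘(ℂ, EE n) 𝓘(ℂ, EE n) (extChartAt 𝓘(ℂ, EE n) x).symm z v)
    (mfderiv 𝓘(ℂ, EE n) 𝓘(ℂ, EE n) (extChartAt 𝓘(ℂ, EE n) x).symm z w)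

/-- A Kähler metric: a smooth Hermitian metric with closed fundamental form. -/
structure KahlerMetric (n : ℕ) (X : Type*) [TopologicalSpace X] [ChartedSpace (EE n) X] where
  form : SesqField n X
  conj_symm : ∀ (x : X) (v w : TangentSpace 𝓘(ℂ, EE n) x),
    form x w v = starRingEnd ℂ (form x v w)
  pos : ∀ (x : X) (v : TangentSpace 𝓘(ℂ, EE n) x), v ≠ 0 → 0 < (form x v v).re
  smooth : ∀ (x : X) (v w : EE n),
    ContDiffOn ℝ ∞ (fun z => form.inChart x z v w) (extChartAt 𝓘(ℂ, EE n) x).target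
  closed : ∀ (x : X), ∀ z ∈ (extChartAt 𝓘(ℂ, EE n) x).target, ∀ a b c : EE n,
    fderiv ℝ (fun z' => fundForm (form.inChart x) z' b c) z a
      + fderiv ℝ (fun z' => fundForm (form.inChart x) z' c a) z b
      + fderiv ℝ (fun z' => fundForm (form.inChart x) z' a b) z c = 0

/-- A real covector at each point. -/
abbrev CovectorField (n : ℕ) (M : Type*) [TopologicalSpace M] [ChartedSpace (VV n) M] : Type _ :=
  ∀ p : M, TangentSpace 𝓘(ℝ, VV n) p →ₗ[ℝ] ℝ

/-- The expression of a covector field in the chart at `p`. -/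
def CovectorField.inChart (θ : CovectorField n M) (p : M) (u v : VV n) : ℝ :=
  θ ((extChartAt 𝓘(ℝ, VV n) p).symm u)
    (mfderiv 𝓘(ℝ, VV n) 𝓘(ℝ, VV n) (extChartAt 𝓘(ℝ, VV n) p).symm u v)

/-- A smooth real 1-form. -/
structure OneForm (n : ℕ) (M : Type*) [TopologicalSpace M] [ChartedSpace (VV n) M] where
  form : CovectorField n M
  smooth : ∀ (p : M) (v : VV n),
    ContDiffOn ℝ ∞ (fun u => form.inChart p u v) (extChartAt 𝓘(ℝ, VV n) p).target

/-- The expressions of `ι`, `θ` and the metric in the chart of `M` at `p` and the holomorphic chart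
of `X` at `ι p`. -/
def localData (g : KahlerMetric n X) (θ : OneForm n M) (ι : M → X) (p : M) : LocalData n where
  F := fun u => extChartAt 𝓘(ℂ, EE n) (ι p) (ι ((extChartAt 𝓘(ℝ, VV n) p).symm u))
  θ := θ.form.inChart p
  h := g.form.inChart (ι p)

/-- The coordinates of `p` in the chart at `p`. -/
def base (n : ℕ) {M : Type*} [TopologicalSpace M] [ChartedSpace (VV n) M] (p : M) : VV n :=
  extChartAt 𝓘(ℝ, VV n) p p

/-- `ι : (M,θ) → (X,ω)` is a real hypersurface of the Kähler manifold, `θ` is a pseudohermitian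
structure on it, and `dθ = ι^* ω`. -/
structure IsSemiIsometricHypersurface (g : KahlerMetric n X) (θ : OneForm n M) (ι : M → X) :
    Prop where
  smooth : ContMDiff 𝓘(ℝ, VV n) 𝓘(ℝ, EE n) ∞ ι
  local_eqs : ∀ p : M, ∀ᶠ u in 𝓝 (base n p), (localData g θ ι p).IsSemiIsometricAt u

/-- `z`, given by its coordinates in the chart at `p`, is in `T^{1,0}M` at `p`. -/
def T10 (g : KahlerMetric n X) (θ : OneForm n M) (ι : M → X) (p : M) (z : VC n) : Prop :=
  (localData g θ ι p).IsT10 (base n p) z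

/-- The Tanaka-Webster holomorphic sectional curvature `K`. -/
def holSec (g : KahlerMetric n X) (θ : OneForm n M) (ι : M → X) (p : M) (z : VC n) : ℂ :=
  (localData g θ ι p).holSec (base n p) z

/-- The holomorphic sectional torsion `A`. -/
def holTor (g : KahlerMetric n X) (θ : OneForm n M) (ι : M → X) (p : M) (z : VC n) : ℂ :=
  (localData g θ ι p).holTor (base n p) z

/-- The holomorphic sectional curvature `K̃` of the ambient Kähler metric. -/
def ambientHolSec (g : KahlerMetric n X) (θ : OneForm n M) (ι : M → X) (p : M) (z : VC n) : ℂ :=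
  (localData g θ ι p).ambientHolSec (base n p) z

/-- `|H|²`, the squared length of the `(1,0)`-mean curvature vector. -/
def meanCurvSq (g : KahlerMetric n X) (θ : OneForm n M) (ι : M → X) (p : M) : ℝ :=
  (localData g θ ι p).meanCurvSq (base n p)

/-- The pseudohermitian torsion vanishes on `T^{1,0}M`, hence identically: `τT = 0`, and `τ` is
real. -/
def VanishingTorsion (g : KahlerMetric n X) (θ : OneForm n M) (ι : M → X) : Prop :=
  ∀ (p : M) (z : VC n), T10 g θ ι p z → (localData g θ ι p).tauAt (base n p) z = 0

/-- `II(Z,W) = 0` for all `(1,0)`-vectors `Z` and `W`. -/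
def TotallyUmbilical (g : KahlerMetric n X) (θ : OneForm n M) (ι : M → X) : Prop :=
  ∀ (p : M) (z w : VC n), T10 g θ ι p z → T10 g θ ι p w →
    (localData g θ ι p).secondFFAt (base n p) z w = 0

end Global

end SemiIsometric

end

/-! Let N be the (1,0)-part of the image of the Reeb field T (`normal`). Since dθ is the pullback of
ω and dθ(T, ·) = 0, the image of T^{1,0}M is exactly the h-orthogonal complement of N
(`exists_isT10_push_eq`), the Levi metric is the restriction of h (`levi_eq`), and a complex tangent
vector Y has N-component θ(Y) N (`push_proj10`).

Pull the Chern connection back to a connection D = `covD` along F. It is metric (`dirD_h`),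
torsion-free because ω is closed (`covD_push_sub`), and its curvature is the ambient one
(`covD_curvature`). Comparison with the structure equations shows that ∇_Y W is the orthogonal
projection of D_Y W - θ(Y) D_W N (`nabla_spec`, `push_nabla`). Everything else is read off from N:

II(Z̄, W) = i⟨W, Z̄⟩ N, because the N-component of D_Z̄ W is θ([Z̄, W]) N; hence H = iN and |H|² =
|N|² (`meanCurv_eq`). The conjugate of τZ is D_Z̄ N (`conjVec_tauAt`); differentiating ⟨W, N̄⟩ = 0
then gives II(Z, W) = -(⟨τZ, W⟩/|N|²) N (`secondFFAt_eq`). This yields the equivalence of vanishing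
torsion and umbilicity (`tauAt_eq_zero_iff`).

The main identity is a Gauss equation (`levi_curv`): ⟨R(Z,Z̄)Z, Z̄⟩ = ⟨R̃(Z,Z̄)Z, Z̄⟩ + 2|Z|⁴|N|² -
|⟨τZ, Z⟩|²/|N|². Division by 2|Z|⁴ gives the claim.

Most geometric objects are chosen by `Classical.epsilon`. Each such choice needs an existence proof;
where fields are differentiated, smoothness comes from characterizing them by injective linear
systems with smooth coefficients (`contDiffAt_of_linear_eq`), or from explicit formulas built on
these. -/

namespace SemiIsometric

/-! ### Conjugation and real parts of coordinate vectors -/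

section Vectors

variable {k : ℕ}

@[simp] theorem conjVec_apply (z : EuclideanSpace ℂ (Fin k)) (a : Fin k) :
    conjVec z a = starRingEnd ℂ (z a) := rfl

@[simp] theorem ofRealVec_apply (v : EuclideanSpace ℝ (Fin k)) (a : Fin k) :
    ofRealVec v a = (v a : ℂ) := rfl

@[simp] theorem reVec_apply (z : EuclideanSpace ℂ (Fin k)) (a : Fin k) :
    reVec z a = (z a).re := rfl

@[simp] theorem conjVec_conjVec (z : EuclideanSpace ℂ (Fin k)) : conjVec (conjVec z) = z := by
  ext a; simp

@[simp] theorem conjVec_zero : conjVec (0 : EuclideanSpace ℂ (Fin k)) = 0 := by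
  ext a; simp

theorem conjVec_add (z w : EuclideanSpace ℂ (Fin k)) :
    conjVec (z + w) = conjVec z + conjVec w := by
  ext a; simp

theorem conjVec_sub (z w : EuclideanSpace ℂ (Fin k)) :
    conjVec (z - w) = conjVec z - conjVec w := by
  ext a; simp

theorem conjVec_smul (c : ℂ) (z : EuclideanSpace ℂ (Fin k)) :
    conjVec (c • z) = starRingEnd ℂ c • conjVec z := by
  ext a; simp

theorem conjVec_sum {ι : Type*} (s : Finset ι) (z : ι → EuclideanSpace ℂ (Fin k)) :
    conjVec (∑ i ∈ s, z i) = ∑ i ∈ s, conjVec (z i) := by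
  classical
  induction s using Finset.induction_on with
  | empty => simp
  | insert a s ha ih => rw [Finset.sum_insert ha, Finset.sum_insert ha, conjVec_add, ih]

@[simp] theorem conjVec_eq_zero (z : EuclideanSpace ℂ (Fin k)) : conjVec z = 0 ↔ z = 0 :=
  ⟨fun h => by rw [← conjVec_conjVec z, h, conjVec_zero], fun h => by rw [h, conjVec_zero]⟩

@[simp] theorem conjVec_ofRealVec (v : EuclideanSpace ℝ (Fin k)) :
    conjVec (ofRealVec v) = ofRealVec v := by
  ext a; simp

theorem ofRealVec_reVec (z : EuclideanSpace ℂ (Fin k)) :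
    ofRealVec (reVec z) = (1 / 2 : ℂ) • (z + conjVec z) := by
  ext a
  simp [← mul_add, Complex.add_conj]

/-- Conjugation as a real-linear continuous map. -/
noncomputable def conjCLM (k : ℕ) : EuclideanSpace ℂ (Fin k) →L[ℝ] EuclideanSpace ℂ (Fin k) :=
  LinearMap.toContinuousLinearMap
    { toFun := conjVec
      map_add' := conjVec_add
      map_smul' := fun c z => by ext a; simp }

@[simp] theorem conjCLM_apply (z : EuclideanSpace ℂ (Fin k)) : conjCLM k z = conjVec z := rfl

/-- The inclusion of real vectors as a real-linear continuous map. -/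
noncomputable def ofRealCLM (k : ℕ) : EuclideanSpace ℝ (Fin k) →L[ℝ] EuclideanSpace ℂ (Fin k) :=
  LinearMap.toContinuousLinearMap
    { toFun := ofRealVec
      map_add' := fun z w => by ext a; simp
      map_smul' := fun c z => by ext a; simp }

@[simp] theorem ofRealCLM_apply (z : EuclideanSpace ℝ (Fin k)) : ofRealCLM k z = ofRealVec z := rfl

end Vectors

theorem sum_smul_coordVec {n : ℕ} (v : VV n) : ∑ a, v a • (coordVec a : VV n) = v := by
  ext b
  simp [coordVec, Finset.sum_apply, Pi.single_apply]

/-! ### Smooth families of linear maps -/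

section Families

variable {D E E' : Type*} [NormedAddCommGroup D] [NormedSpace ℝ D]
  [NormedAddCommGroup E] [NormedSpace ℝ E] [FiniteDimensional ℝ E]
  [NormedAddCommGroup E'] [NormedSpace ℝ E']

theorem contDiffAt_clm_of_apply {f : D → E →L[ℝ] E'} {x : D} {m : WithTop ℕ∞}
    (hf : ∀ v, ContDiffAt ℝ m (fun x => f x v) x) : ContDiffAt ℝ m f x := by
  let d := Module.finrank ℝ E
  have hd : d = Module.finrank ℝ (Fin d → ℝ) := (Module.finrank_fin_fun ℝ).symm
  let e₁ := ContinuousLinearEquiv.ofFinrankEq hd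
  let e₂ := (e₁.arrowCongr (1 : E' ≃L[ℝ] E')).trans (ContinuousLinearEquiv.piRing (Fin d))
  rw [← Function.id_comp f, ← e₂.symm_comp_self]
  exact e₂.symm.contDiff.contDiffAt.comp x (contDiffAt_pi.mpr fun i => hf _)

/-- A solution of a smooth family of injective linear equations is smooth. -/
theorem contDiffAt_of_linear_eq [FiniteDimensional ℝ E'] {A : D → E →ₗ[ℝ] E'} {y : D → E'}
    {x : D → E} {u : D} {m : WithTop ℕ∞} (hA : ∀ v, ContDiffAt ℝ m (fun u' => A u' v) u)
    (hinj : Function.Injective (A u)) (hy : ContDiffAt ℝ m y u)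
    (h : ∀ᶠ u' in 𝓝 u, A u' (x u') = y u') : ContDiffAt ℝ m x u := by
  -- L is a left inverse at the base point only. L ∘ A u' is the identity at u' = u, hence
  -- invertible nearby with smooth inverse, and x = (L ∘ A)⁻¹ (L y) there.
  obtain ⟨L, hL⟩ := (A u).exists_leftInverse_of_injective (LinearMap.ker_eq_bot.mpr hinj)
  let B : D → E →L[ℝ] E := fun u' => LinearMap.toContinuousLinearMap (L ∘ₗ A u')
  have hB : ContDiffAt ℝ m B u := contDiffAt_clm_of_apply fun v =>
    (LinearMap.toContinuousLinearMap L).contDiff.contDiffAt.comp u (hA v)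
  have hBu : B u = (ContinuousLinearEquiv.refl ℝ E : E →L[ℝ] E) := by
    ext v
    simp [B, hL]
  have hinv : ContDiffAt ℝ m (fun u' => ContinuousLinearMap.inverse (B u')) u := by
    have := contDiffAt_map_inverse (𝕜 := ℝ) (n := m) (ContinuousLinearEquiv.refl ℝ E)
    rw [← hBu] at this
    exact this.comp u hB
  have hLy : ContDiffAt ℝ m (fun u' => L (y u')) u :=
    (LinearMap.toContinuousLinearMap L).contDiff.contDiffAt.comp u hy
  refine (hinv.clm_apply hLy).congr_of_eventuallyEq ?_
  have hunit : ∀ᶠ u' in 𝓝 u, B u' ∈ Set.range ((↑) : (E ≃L[ℝ] E) → E →L[ℝ] E) := by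
    have := (ContinuousLinearEquiv.refl ℝ E).nhds
    rw [← hBu] at this
    exact hB.continuousAt.eventually this
  filter_upwards [h, hunit] with u' h1 ⟨e, he⟩
  rw [← h1, ← he, ContinuousLinearMap.inverse_equiv]
  have : L (A u' (x u')) = e (x u') := by
    change B u' (x u') = _
    rw [← he]; rfl
  simp [this]

end Families

/-! ### Derivatives along complex vectors -/

section Derivatives

variable {n : ℕ} {G : Type*} [NormedAddCommGroup G] [NormedSpace ℂ G]

theorem dirD_add_left (Z W : VC n) (f : VV n → G) (u : VV n) :
    dirD (Z + W) f u = dirD Z f u + dirD W f u := by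
  simp [dirD, add_smul, Finset.sum_add_distrib]

theorem dirD_sub_left (Z W : VC n) (f : VV n → G) (u : VV n) :
    dirD (Z - W) f u = dirD Z f u - dirD W f u := by
  simp [dirD, sub_smul, Finset.sum_sub_distrib]

theorem dirD_smul_left (c : ℂ) (Z : VC n) (f : VV n → G) (u : VV n) :
    dirD (c • Z) f u = c • dirD Z f u := by
  simp [dirD, mul_smul, Finset.smul_sum]

@[simp] theorem dirD_zero_left (f : VV n → G) (u : VV n) : dirD (0 : VC n) f u = 0 := by
  simp [dirD]

theorem dirD_ofRealVec (v : VV n) (f : VV n → G) (u : VV n) :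
    dirD (ofRealVec v) f u = fderiv ℝ f u v := by
  conv_rhs => rw [← sum_smul_coordVec v, map_sum]
  simp [dirD]

theorem dirD_congr {f g : VV n → G} {u : VV n} (h : f =ᶠ[𝓝 u] g) (Z : VC n) :
    dirD Z f u = dirD Z g u := by
  simp only [dirD, h.fderiv_eq]

@[simp] theorem dirD_const (Z : VC n) (c : G) (u : VV n) : dirD Z (fun _ => c) u = 0 := by
  simp [dirD]

theorem dirD_add {f g : VV n → G} {u : VV n} (hf : DifferentiableAt ℝ f u)
    (hg : DifferentiableAt ℝ g u) (Z : VC n) :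
    dirD Z (fun u => f u + g u) u = dirD Z f u + dirD Z g u := by
  simp [dirD, fderiv_fun_add hf hg, Finset.sum_add_distrib]

theorem dirD_sub {f g : VV n → G} {u : VV n} (hf : DifferentiableAt ℝ f u)
    (hg : DifferentiableAt ℝ g u) (Z : VC n) :
    dirD Z (fun u => f u - g u) u = dirD Z f u - dirD Z g u := by
  simp [dirD, fderiv_fun_sub hf hg, Finset.sum_sub_distrib, smul_sub]

theorem dirD_sum {ι : Type*} (s : Finset ι) {f : ι → VV n → G} {u : VV n}
    (hf : ∀ i ∈ s, DifferentiableAt ℝ (f i) u) (Z : VC n) :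
    dirD Z (fun u => ∑ i ∈ s, f i u) u = ∑ i ∈ s, dirD Z (f i) u := by
  simp only [dirD, fderiv_fun_sum hf, sum_apply, Finset.smul_sum]
  exact Finset.sum_comm

theorem dirD_smul {c : VV n → ℂ} {f : VV n → G} {u : VV n} (hc : DifferentiableAt ℝ c u)
    (hf : DifferentiableAt ℝ f u) (Z : VC n) :
    dirD Z (fun u => c u • f u) u = c u • dirD Z f u + dirD Z c u • f u := by
  simp only [dirD, fderiv_fun_smul hc hf, Finset.smul_sum, Finset.sum_smul,
    ← Finset.sum_add_distrib]
  refine Finset.sum_congr rfl fun a _ => ?_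
  simp [smul_add, smul_smul, mul_comm]

theorem dirD_clm {G' : Type*} [NormedAddCommGroup G'] [NormedSpace ℂ G'] (L : G →L[ℂ] G')
    {f : VV n → G} {u : VV n} (hf : DifferentiableAt ℝ f u) (Z : VC n) :
    dirD Z (fun u => L (f u)) u = L (dirD Z f u) := by
  have h : HasFDerivAt (fun u => L (f u)) ((L.restrictScalars ℝ).comp (fderiv ℝ f u)) u :=
    (L.restrictScalars ℝ).hasFDerivAt.comp u hf.hasFDerivAt
  simp [dirD, h.fderiv, map_sum]

theorem dirD_conjVec {k : ℕ} {f : VV n → EuclideanSpace ℂ (Fin k)} {u : VV n}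
    (hf : DifferentiableAt ℝ f u) (Z : VC n) :
    dirD Z (fun u => conjVec (f u)) u = conjVec (dirD (conjVec Z) f u) := by
  have h : HasFDerivAt (fun u => conjVec (f u)) ((conjCLM k).comp (fderiv ℝ f u)) u :=
    (conjCLM k).hasFDerivAt.comp u hf.hasFDerivAt
  simp [dirD, h.fderiv, conjVec_sum, conjVec_smul]

theorem differentiableAt_coord {k : ℕ} {f : VV n → EuclideanSpace ℂ (Fin k)} {u : VV n}
    (hf : DifferentiableAt ℝ f u) (a : Fin k) : DifferentiableAt ℝ (fun u => f u a) u :=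
  ((EuclideanSpace.proj (𝕜 := ℂ) a).restrictScalars ℝ).differentiableAt.comp u hf

theorem contDiffAt_coord {k : ℕ} {m : WithTop ℕ∞} {f : VV n → EuclideanSpace ℂ (Fin k)} {u : VV n}
    (hf : ContDiffAt ℝ m f u) (a : Fin k) : ContDiffAt ℝ m (fun u => f u a) u :=
  ((EuclideanSpace.proj (𝕜 := ℂ) a).restrictScalars ℝ).contDiff.contDiffAt.comp u hf

theorem dirD_coord {k : ℕ} {f : VV n → EuclideanSpace ℂ (Fin k)} {u : VV n}
    (hf : DifferentiableAt ℝ f u) (Z : VC n) (a : Fin k) :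
    dirD Z (fun u => f u a) u = dirD Z f u a :=
  dirD_clm (EuclideanSpace.proj (𝕜 := ℂ) a) hf Z

theorem contDiffAt_dirD {Z : VV n → VC n} {f : VV n → G} {u : VV n} (hZ : ContDiffAt ℝ ∞ Z u)
    (hf : ContDiffAt ℝ ∞ f u) : ContDiffAt ℝ ∞ (fun u => dirD (Z u) f u) u := by
  refine ContDiffAt.sum fun a _ => (contDiffAt_coord hZ a).smul ?_
  exact (hf.fderiv_right (m := ∞) (by simp)).clm_apply contDiffAt_const

/-- In the iterated derivatives the first-order terms assemble into the bracket; the second-order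
ones cancel by symmetry of the second derivative. Torsion-freeness and the curvature formula for
`covD` both rest on this. -/
theorem dirD_bracket {X Y : VV n → VC n} {f : VV n → G} {u : VV n} (hX : DifferentiableAt ℝ X u)
    (hY : DifferentiableAt ℝ Y u) (hf : ContDiffAt ℝ 2 f u) :
    dirD (bracket X Y u) f u
      = dirD (X u) (fun u => dirD (Y u) f u) u - dirD (Y u) (fun u => dirD (X u) f u) u := by
  have hd : DifferentiableAt ℝ (fderiv ℝ f) u :=
    (hf.fderiv_right (m := 1) (by norm_num)).differentiableAt (by norm_num)
  have hda : ∀ a, DifferentiableAt ℝ (fun u => fderiv ℝ f u (coordVec a)) u := fun a =>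
    hd.clm_apply (differentiableAt_const _)
  have key : ∀ X Y : VV n → VC n, DifferentiableAt ℝ Y u →
      dirD (X u) (fun u => dirD (Y u) f u) u = dirD (dirD (X u) Y u) f u
        + ∑ a, ∑ b, (X u b * Y u a) • fderiv ℝ (fderiv ℝ f) u (coordVec b) (coordVec a) := by
    intro X Y hY
    simp only [dirD.eq_1 (Y _)]
    rw [dirD_sum _ (fun a _ => (differentiableAt_coord hY a).fun_smul (hda a))]
    simp only [dirD_smul (differentiableAt_coord hY _) (hda _), dirD_coord hY]
    rw [Finset.sum_add_distrib, add_comm]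
    congr 1
    refine Finset.sum_congr rfl fun a _ => ?_
    rw [dirD, Finset.smul_sum]
    refine Finset.sum_congr rfl fun b _ => ?_
    rw [fderiv_clm_apply hd (differentiableAt_const _)]
    simp [smul_smul, mul_comm]
  have hsymm : IsSymmSndFDerivAt ℝ f u := hf.isSymmSndFDerivAt (by simp)
  rw [key X Y hY, key Y X hX, bracket, dirD_sub_left]
  have : ∑ a, ∑ b, (X u b * Y u a) • fderiv ℝ (fderiv ℝ f) u (coordVec b) (coordVec a)
      = ∑ a, ∑ b, (Y u b * X u a) • fderiv ℝ (fderiv ℝ f) u (coordVec b) (coordVec a) := by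
    rw [Finset.sum_comm]
    refine Finset.sum_congr rfl fun a _ => Finset.sum_congr rfl fun b _ => ?_
    rw [hsymm.eq (coordVec b), mul_comm (X u a)]
  rw [this]
  abel

end Derivatives

end SemiIsometric

namespace SemiIsometric

/-! ### Smooth families of bilinear maps -/

section Bilinear

variable {D E E' G : Type*} [NormedAddCommGroup D] [NormedSpace ℝ D]
  [NormedAddCommGroup E] [NormedSpace ℝ E] [FiniteDimensional ℝ E]
  [NormedAddCommGroup E'] [NormedSpace ℝ E'] [FiniteDimensional ℝ E']
  [NormedAddCommGroup G] [NormedSpace ℝ G]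

theorem exists_clm_of_bilinear {b : D → E → E' → G} {u : D} {m : WithTop ℕ∞}
    (hb : ∀ᶠ u' in 𝓝 u, IsBilinearMap ℝ (b u'))
    (hs : ∀ v w, ContDiffAt ℝ m (fun u' => b u' v w) u) :
    ∃ B : D → E →L[ℝ] E' →L[ℝ] G, ContDiffAt ℝ m B u ∧
      ∀ᶠ u' in 𝓝 u, ∀ v w, B u' v w = b u' v w := by
  classical
  -- Bilinearity is known only near u; the value 0 elsewhere is harmless because the statement is
  -- local.
  let B : D → E →L[ℝ] E' →L[ℝ] G := fun u' =>
    if h : IsBilinearMap ℝ (b u') then h.toContinuousBilinearMap else 0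
  have hB : ∀ᶠ u' in 𝓝 u, ∀ v w, B u' v w = b u' v w := by
    filter_upwards [hb] with u' h v w
    simp only [B, dif_pos h]
    rfl
  refine ⟨B, contDiffAt_clm_of_apply fun v => contDiffAt_clm_of_apply fun w => ?_, hB⟩
  exact (hs v w).congr_of_eventuallyEq (hB.mono fun u' h => h v w)

theorem contDiffAt_bilinear {b : D → E → E' → G} {u : D} {m : WithTop ℕ∞}
    (hb : ∀ᶠ u' in 𝓝 u, IsBilinearMap ℝ (b u'))
    (hs : ∀ v w, ContDiffAt ℝ m (fun u' => b u' v w) u) {S₁ : D → E} {S₂ : D → E'}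
    (h₁ : ContDiffAt ℝ m S₁ u) (h₂ : ContDiffAt ℝ m S₂ u) :
    ContDiffAt ℝ m (fun u' => b u' (S₁ u') (S₂ u')) u := by
  obtain ⟨B, hB, hBb⟩ := exists_clm_of_bilinear hb hs
  exact ((hB.clm_apply h₁).clm_apply h₂).congr_of_eventuallyEq
    (hBb.mono fun u' h => (h _ _).symm)

theorem fderiv_bilinear {b : D → E → E' → G} {u : D}
    (hb : ∀ᶠ u' in 𝓝 u, IsBilinearMap ℝ (b u'))
    (hs : ∀ v w, ContDiffAt ℝ ∞ (fun u' => b u' v w) u) {S₁ : D → E} {S₂ : D → E'}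
    (h₁ : DifferentiableAt ℝ S₁ u) (h₂ : DifferentiableAt ℝ S₂ u) (x : D) :
    fderiv ℝ (fun u' => b u' (S₁ u') (S₂ u')) u x
      = fderiv ℝ (fun u' => b u' (S₁ u) (S₂ u)) u x + b u (fderiv ℝ S₁ u x) (S₂ u)
        + b u (S₁ u) (fderiv ℝ S₂ u x) := by
  obtain ⟨B, hB, hBb⟩ := exists_clm_of_bilinear hb hs
  have hBd : DifferentiableAt ℝ B u := hB.differentiableAt (by simp)
  have e₁ : (fun u' => b u' (S₁ u') (S₂ u')) =ᶠ[𝓝 u] fun u' => B u' (S₁ u') (S₂ u') :=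
    hBb.mono fun u' h => (h _ _).symm
  have e₂ : (fun u' => b u' (S₁ u) (S₂ u)) =ᶠ[𝓝 u] fun u' => B u' (S₁ u) (S₂ u) :=
    hBb.mono fun u' h => (h _ _).symm
  have hu := hBb.self_of_nhds
  rw [e₁.fderiv_eq, e₂.fderiv_eq, ← hu, ← hu,
    fderiv_clm_apply (hBd.clm_apply h₁) h₂, fderiv_clm_apply hBd h₁,
    fderiv_clm_apply (hBd.clm_apply (differentiableAt_const _)) (differentiableAt_const _),
    fderiv_clm_apply hBd (differentiableAt_const _)]
  simp
  abel

end Bilinear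

/-! ### Derivatives of type `(1,0)` and `(0,1)` -/

section Types

variable {n : ℕ} {G : Type*} [NormedAddCommGroup G] [NormedSpace ℂ G]

theorem fderiv_complex_smul (f : EE n → G) (z v : EE n) (c : ℂ) :
    fderiv ℝ f z (c • v)
      = (c.re : ℂ) • fderiv ℝ f z v + (c.im : ℂ) • fderiv ℝ f z (Complex.I • v) := by
  have : c • v = c.re • v + c.im • (Complex.I • v) := by
    ext j
    simp only [PiLp.smul_apply, PiLp.add_apply, smul_eq_mul, Complex.real_smul]
    conv_lhs => rw [← Complex.re_add_im c]
    ring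
  rw [this, map_add, map_smul, map_smul]
  simp

theorem dHol_add_dAnti (v : EE n) (f : EE n → G) (z : EE n) :
    dHol v f z + dAnti v f z = fderiv ℝ f z v := by
  rw [dHol, dAnti, ← smul_add, sub_add_add_cancel, ← two_smul ℂ, smul_smul]
  norm_num

theorem dHol_add (v w : EE n) (f : EE n → G) (z : EE n) :
    dHol (v + w) f z = dHol v f z + dHol w f z := by
  simp only [dHol, smul_add, map_add]
  module

theorem dAnti_add (v w : EE n) (f : EE n → G) (z : EE n) :
    dAnti (v + w) f z = dAnti v f z + dAnti w f z := by
  simp only [dAnti, smul_add, map_add]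
  module

theorem dHol_smul (c : ℂ) (v : EE n) (f : EE n → G) (z : EE n) :
    dHol (c • v) f z = c • dHol v f z := by
  rw [dHol, dHol, smul_smul Complex.I, fderiv_complex_smul f z v c,
    fderiv_complex_smul f z v (Complex.I * c)]
  simp only [smul_smul, smul_add, smul_sub]
  conv_rhs => rw [← Complex.re_add_im c]
  simp only [Complex.mul_re, Complex.mul_im, Complex.I_re, Complex.I_im]
  match_scalars <;> ring_nf
  all_goals simp [Complex.I_sq]
  all_goals ring

theorem dAnti_smul (c : ℂ) (v : EE n) (f : EE n → G) (z : EE n) :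
    dAnti (c • v) f z = starRingEnd ℂ c • dAnti v f z := by
  have hc : starRingEnd ℂ c = c.re - c.im * Complex.I := by
    apply Complex.ext <;> simp
  rw [hc, dAnti, dAnti, smul_smul Complex.I, fderiv_complex_smul f z v c,
    fderiv_complex_smul f z v (Complex.I * c)]
  simp only [smul_smul, smul_add]
  simp only [Complex.mul_re, Complex.mul_im, Complex.I_re, Complex.I_im]
  match_scalars <;> ring_nf
  all_goals simp [Complex.I_sq]
  all_goals ring

@[simp] theorem dHol_zero (f : EE n → G) (z : EE n) : dHol (0 : EE n) f z = 0 := by simp [dHol]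

theorem dHol_sum {ι : Type*} (s : Finset ι) (v : ι → EE n) (f : EE n → G) (z : EE n) :
    dHol (∑ i ∈ s, v i) f z = ∑ i ∈ s, dHol (v i) f z := by
  classical
  induction s using Finset.induction_on with
  | empty => simp
  | insert a s ha ih => rw [Finset.sum_insert ha, Finset.sum_insert ha, dHol_add, ih]

theorem dAnti_sum {ι : Type*} (s : Finset ι) (v : ι → EE n) (f : EE n → G) (z : EE n) :
    dAnti (∑ i ∈ s, v i) f z = ∑ i ∈ s, dAnti (v i) f z := by
  classical
  induction s using Finset.induction_on with
  | empty => simp [dAnti]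
  | insert a s ha ih => rw [Finset.sum_insert ha, Finset.sum_insert ha, dAnti_add, ih]

/-- The image of Z under dF has (1,0)-part `dirD Z F u` and (0,1)-part the conjugate of `dirD
(conjVec Z) F u`; each part differentiates f by its own operator. -/
theorem dirD_comp {f : EE n → G} {F : VV n → EE n} {u : VV n}
    (hf : DifferentiableAt ℝ f (F u)) (hF : DifferentiableAt ℝ F u) (Z : VC n) :
    dirD Z (fun u => f (F u)) u
      = dHol (dirD Z F u) f (F u) + dAnti (dirD (conjVec Z) F u) f (F u) := by
  have h : HasFDerivAt (fun u => f (F u)) ((fderiv ℝ f (F u)).comp (fderiv ℝ F u)) u :=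
    hf.hasFDerivAt.comp u hF.hasFDerivAt
  simp only [dirD, h.fderiv, dHol_sum, dAnti_sum, dHol_smul, dAnti_smul,
    ← Finset.sum_add_distrib, conjVec_apply, Complex.conj_conj, ← smul_add, dHol_add_dAnti]
  rfl

theorem dHol_conj {f : EE n → ℂ} {z : EE n} (hf : DifferentiableAt ℝ f z) (v : EE n) :
    dHol v (fun z => starRingEnd ℂ (f z)) z = starRingEnd ℂ (dAnti v f z) := by
  have h : HasFDerivAt (fun z => starRingEnd ℂ (f z))
      ((Complex.conjCLE : ℂ →L[ℝ] ℂ).comp (fderiv ℝ f z)) z :=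
    (Complex.conjCLE : ℂ →L[ℝ] ℂ).hasFDerivAt.comp z hf.hasFDerivAt
  have h2 : starRingEnd ℂ 2 = 2 := Complex.conj_ofNat 2
  simp [dHol, dAnti, h.fderiv, h2, sub_eq_add_neg]

theorem dHol_sum_mul {ι : Type*} (s : Finset ι) (c : ι → ℂ) {f : ι → EE n → ℂ} {z : EE n}
    (hf : ∀ i ∈ s, DifferentiableAt ℝ (f i) z) (v : EE n) :
    dHol v (fun z => ∑ i ∈ s, c i * f i z) z = ∑ i ∈ s, c i * dHol v (f i) z := by
  have h : HasFDerivAt (fun z => ∑ i ∈ s, c i * f i z) (∑ i ∈ s, c i • fderiv ℝ (f i) z) z :=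
    HasFDerivAt.fun_sum fun i hi => (hf i hi).hasFDerivAt.const_mul (c i)
  simp only [dHol, h.fderiv, sum_apply, smul_apply, smul_eq_mul,
    Finset.mul_sum, ← Finset.sum_sub_distrib]
  exact Finset.sum_congr rfl fun i _ => by ring

theorem contDiffAt_dHol {f : EE n → G} {z : EE n} (hf : ContDiffAt ℝ ∞ f z) (v : EE n) :
    ContDiffAt ℝ ∞ (fun z => dHol v f z) z := by
  have h := hf.fderiv_right (m := ∞) (by simp)
  exact contDiffAt_const.smul ((h.clm_apply contDiffAt_const).sub
    (contDiffAt_const.smul (h.clm_apply contDiffAt_const)))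

end Types

/-! ### Kähler metrics in coordinates -/

/-- `h` restricts to a Kähler metric on the open set `Ω`. -/
structure IsKahlerOn {n : ℕ} (h : EE n → EE n → EE n → ℂ) (Ω : Set (EE n)) : Prop where
  isOpen : IsOpen Ω
  add_left : ∀ z v v' w, h z (v + v') w = h z v w + h z v' w
  smul_left : ∀ (z : EE n) (c : ℂ) (v w : EE n), h z (c • v) w = c * h z v w
  conj_symm : ∀ z v w, h z w v = starRingEnd ℂ (h z v w)
  pos : ∀ z ∈ Ω, ∀ v, v ≠ 0 → 0 < (h z v v).re
  smooth : ∀ z ∈ Ω, ∀ v w, ContDiffAt ℝ ∞ (fun z => h z v w) z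
  closed : ∀ z ∈ Ω, ∀ a b c : EE n,
    fderiv ℝ (fun z' => fundForm h z' b c) z a
      + fderiv ℝ (fun z' => fundForm h z' c a) z b
      + fderiv ℝ (fun z' => fundForm h z' a b) z c = 0

namespace IsKahlerOn

variable {n : ℕ} {h : EE n → EE n → EE n → ℂ} {Ω : Set (EE n)} (hh : IsKahlerOn h Ω)
include hh

theorem add_right (z v w w' : EE n) : h z v (w + w') = h z v w + h z v w' := by
  rw [hh.conj_symm, hh.add_left, map_add, ← hh.conj_symm, ← hh.conj_symm]

theorem smul_right (z : EE n) (c : ℂ) (v w : EE n) :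
    h z v (c • w) = starRingEnd ℂ c * h z v w := by
  rw [hh.conj_symm, hh.smul_left, map_mul, ← hh.conj_symm]

theorem zero_left (z w : EE n) : h z 0 w = 0 := by
  simpa using hh.smul_left z 0 0 w

theorem zero_right (z w : EE n) : h z w 0 = 0 := by
  simpa using hh.smul_right z 0 w 0

theorem sub_left (z v v' w : EE n) : h z (v - v') w = h z v w - h z v' w := by
  have := hh.add_left z (v - v') v' w
  rw [sub_add_cancel] at this
  rw [this]; ring

theorem sub_right (z v w w' : EE n) : h z v (w - w') = h z v w - h z v w' := by
  have := hh.add_right z v (w - w') w'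
  rw [sub_add_cancel] at this
  rw [this]; ring

theorem sum_left {ι : Type*} (s : Finset ι) (z : EE n) (v : ι → EE n) (w : EE n) :
    h z (∑ i ∈ s, v i) w = ∑ i ∈ s, h z (v i) w := by
  classical
  induction s using Finset.induction_on with
  | empty => simp [hh.zero_left]
  | insert a s ha ih => rw [Finset.sum_insert ha, Finset.sum_insert ha, hh.add_left, ih]

theorem sum_right {ι : Type*} (s : Finset ι) (z w : EE n) (v : ι → EE n) :
    h z w (∑ i ∈ s, v i) = ∑ i ∈ s, h z w (v i) := by
  classical
  induction s using Finset.induction_on with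
  | empty => simp [hh.zero_right]
  | insert a s ha ih => rw [Finset.sum_insert ha, Finset.sum_insert ha, hh.add_right, ih]

theorem im_self (z v : EE n) : (h z v v).im = 0 :=
  Complex.conj_eq_iff_im.mp (hh.conj_symm z v v).symm

theorem ofReal_re_self (z v : EE n) : ((h z v v).re : ℂ) = h z v v :=
  Complex.ext rfl (by simp [hh.im_self])

theorem self_eq_zero {z : EE n} (hz : z ∈ Ω) {v : EE n} : h z v v = 0 ↔ v = 0 := by
  refine ⟨fun hv => ?_, fun hv => by rw [hv, hh.zero_left]⟩
  by_contra h0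
  have := hh.pos z hz v h0
  simp [hv] at this

theorem ext_left {z : EE n} (hz : z ∈ Ω) {v w : EE n} (H : ∀ y, h z v y = h z w y) : v = w := by
  rw [← sub_eq_zero, ← hh.self_eq_zero hz, hh.sub_left, H, sub_self]

theorem bilinear (z : EE n) : IsBilinearMap ℝ (h z) where
  add_left := hh.add_left z
  add_right := hh.add_right z
  smul_left c v w := by
    have := hh.smul_left z c v w
    simpa using this
  smul_right c v w := by
    have := hh.smul_right z c v w
    simpa using this

theorem sum_coord_right (z v y : EE n) :
    h z v y = ∑ j, starRingEnd ℂ (y j) * h z v (EuclideanSpace.single j 1) := by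
  have : y = ∑ j, y j • (EuclideanSpace.single j 1 : EE n) := by
    ext b
    simp [Finset.sum_apply, Pi.single_apply]
  conv_lhs => rw [this, hh.sum_right]
  simp only [hh.smul_right]

theorem dHol_sum_coord {z : EE n} (hz : z ∈ Ω) (v w y : EE n) :
    dHol v (fun z => h z w y) z
      = ∑ j, starRingEnd ℂ (y j) * dHol v (fun z => h z w (EuclideanSpace.single j 1)) z := by
  simp only [hh.sum_coord_right _ w y]
  exact dHol_sum_mul _ _ (fun j _ => (hh.smooth z hz _ _).differentiableAt (by simp)) v

/-- The components of `h z γ` as a linear map. -/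
noncomputable def components (z : EE n) : EE n →ₗ[ℂ] (Fin (n + 1) → ℂ) where
  toFun γ j := h z γ (EuclideanSpace.single j 1)
  map_add' v w := by ext j; exact hh.add_left _ _ _ _
  map_smul' c w := by ext j; exact hh.smul_left _ _ _ _

theorem components_injective {z : EE n} (hz : z ∈ Ω) : Function.Injective (hh.components z) := by
  rw [← LinearMap.ker_eq_bot, LinearMap.ker_eq_bot']
  intro γ hγ
  rw [← hh.self_eq_zero hz, hh.sum_coord_right]
  refine Finset.sum_eq_zero fun j _ => ?_
  have := congrFun hγ j
  simp only [components, LinearMap.coe_mk, AddHom.coe_mk, Pi.zero_apply] at this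
  rw [this, mul_zero]

/-- Both sides of the defining condition are antilinear in y, so it amounts to n + 1 equations, one
per basis vector. Positivity makes this square system injective, hence solvable. -/
theorem chernSymbol_spec {z : EE n} (hz : z ∈ Ω) (v w y : EE n) :
    h z (chernSymbol h z v w) y = dHol v (fun z' => h z' w y) z := by
  have hex : ∃ γ : EE n, ∀ y : EE n, h z γ y = dHol v (fun z' => h z' w y) z := by
    have hsurj : Function.Surjective (hh.components z) :=
      (LinearMap.injective_iff_surjective_of_finrank_eq_finrank (by simp)).mp
        (hh.components_injective hz)
    obtain ⟨γ, hγ⟩ := hsurj fun j => dHol v (fun z' => h z' w (EuclideanSpace.single j 1)) z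
    refine ⟨γ, fun y => ?_⟩
    rw [hh.sum_coord_right, hh.dHol_sum_coord hz]
    refine Finset.sum_congr rfl fun j _ => ?_
    rw [← congrFun hγ j]
    rfl
  exact Classical.epsilon_spec hex y

theorem differentiableAt {z : EE n} (hz : z ∈ Ω) (v w : EE n) :
    DifferentiableAt ℝ (fun z => h z v w) z :=
  (hh.smooth z hz v w).differentiableAt (by simp)

theorem chernSymbol_smul_left {z : EE n} (hz : z ∈ Ω) (c : ℂ) (v w : EE n) :
    chernSymbol h z (c • v) w = c • chernSymbol h z v w :=
  hh.ext_left hz fun y => by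
    rw [hh.smul_left, hh.chernSymbol_spec hz, hh.chernSymbol_spec hz, dHol_smul, smul_eq_mul]

theorem chernSymbol_add_left {z : EE n} (hz : z ∈ Ω) (v v' w : EE n) :
    chernSymbol h z (v + v') w = chernSymbol h z v w + chernSymbol h z v' w :=
  hh.ext_left hz fun y => by
    simp only [hh.add_left, hh.chernSymbol_spec hz, dHol_add]

theorem fderiv_fundForm {z : EE n} (hz : z ∈ Ω) (a b c : EE n) :
    ((fderiv ℝ (fun z' => fundForm h z' b c) z a : ℝ) : ℂ)
      = Complex.I * (fderiv ℝ (fun z' => h z' b c) z a - fderiv ℝ (fun z' => h z' c b) z a) := by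
  have e₁ : HasFDerivAt (fun z' => fundForm h z' b c)
      ((-2 : ℝ) • Complex.imCLM.comp (fderiv ℝ (fun z' => h z' b c) z)) z :=
    (Complex.imCLM.hasFDerivAt.comp z (hh.differentiableAt hz b c).hasFDerivAt).const_mul (-2)
  have e₂ : HasFDerivAt (fun z' => h z' c b)
      ((Complex.conjCLE : ℂ →L[ℝ] ℂ).comp (fderiv ℝ (fun z' => h z' b c) z)) z := by
    have : (fun z' => h z' c b) = fun z' => starRingEnd ℂ (h z' b c) :=
      funext fun z' => hh.conj_symm z' b c
    rw [this]
    exact (Complex.conjCLE : ℂ →L[ℝ] ℂ).hasFDerivAt.comp z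
      (hh.differentiableAt hz b c).hasFDerivAt
  rw [e₁.fderiv, e₂.fderiv]
  apply Complex.ext <;> simp
  ring

theorem fderiv_smul_left {z : EE n} (hz : z ∈ Ω) (a : EE n) (k : ℂ) (b c : EE n) :
    fderiv ℝ (fun z' => h z' (k • b) c) z a = k * fderiv ℝ (fun z' => h z' b c) z a := by
  simp only [hh.smul_left]
  rw [fderiv_const_mul (hh.differentiableAt hz b c)]
  rfl

theorem fderiv_smul_right {z : EE n} (hz : z ∈ Ω) (a : EE n) (k : ℂ) (b c : EE n) :
    fderiv ℝ (fun z' => h z' b (k • c)) z a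
      = starRingEnd ℂ k * fderiv ℝ (fun z' => h z' b c) z a := by
  simp only [hh.smul_right]
  rw [fderiv_const_mul (hh.differentiableAt hz b c)]
  rfl

/-- The Kähler condition: `v ⟨w, ȳ⟩ = w ⟨v, ȳ⟩` for holomorphic coordinate fields. -/
theorem dHol_symm {z : EE n} (hz : z ∈ Ω) (v w y : EE n) :
    dHol v (fun z' => h z' w y) z = dHol w (fun z' => h z' v y) z := by
  have key : ∀ a b c : EE n,
      (fderiv ℝ (fun z' => h z' b c) z a - fderiv ℝ (fun z' => h z' c b) z a)
      + (fderiv ℝ (fun z' => h z' c a) z b - fderiv ℝ (fun z' => h z' a c) z b)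
      + (fderiv ℝ (fun z' => h z' a b) z c - fderiv ℝ (fun z' => h z' b a) z c) = 0 := by
    intro a b c
    have := congrArg (fun r : ℝ => Complex.I * (r : ℂ)) (hh.closed z hz a b c)
    simp only [Complex.ofReal_add, hh.fderiv_fundForm hz, Complex.ofReal_zero, mul_zero] at this
    linear_combination (-1 : ℂ) * this
      + (-(fderiv ℝ (fun z' => h z' b c) z a - fderiv ℝ (fun z' => h z' c b) z a)
      - (fderiv ℝ (fun z' => h z' c a) z b - fderiv ℝ (fun z' => h z' a c) z b)
      - (fderiv ℝ (fun z' => h z' a b) z c - fderiv ℝ (fun z' => h z' b a) z c))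
        * (-Complex.I_mul_I)
  have k₁ := key v w y
  have k₂ := key (Complex.I • v) w y
  have k₃ := key v (Complex.I • w) y
  have k₄ := key (Complex.I • v) (Complex.I • w) y
  have l₁ := key v w (Complex.I • y)
  have l₂ := key (Complex.I • v) w (Complex.I • y)
  have l₃ := key v (Complex.I • w) (Complex.I • y)
  have l₄ := key (Complex.I • v) (Complex.I • w) (Complex.I • y)
  simp only [hh.fderiv_smul_left hz, hh.fderiv_smul_right hz, Complex.conj_I]
    at k₁ k₂ k₃ k₄ l₁ l₂ l₃ l₄
  simp only [dHol, smul_eq_mul]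
  have I3 : Complex.I ^ 3 = -Complex.I := by rw [pow_succ, Complex.I_sq]; ring
  have I4 : Complex.I ^ 4 = 1 := Complex.I_pow_four
  -- The weights evaluate dω on (v - iJv)/2, (w - iJw)/2 and (y + iJy)/2, which isolates its
  -- (2,1)-component; 1/8 is the product of the three halves.
  linear_combination (norm := skip) (1 / 8 : ℂ) * (k₁ + Complex.I * l₁
    - Complex.I * (k₂ + Complex.I * l₂) - Complex.I * (k₃ + Complex.I * l₃)
    - (k₄ + Complex.I * l₄))
  ring_nf
  simp only [Complex.I_sq, I3, I4]
  ring

/-- Closedness of ω enters the argument only through this symmetry. It also transfers linearity from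
the first slot of Γ to the second. -/
theorem chernSymbol_symm {z : EE n} (hz : z ∈ Ω) (v w : EE n) :
    chernSymbol h z v w = chernSymbol h z w v :=
  hh.ext_left hz fun y => by
    rw [hh.chernSymbol_spec hz, hh.chernSymbol_spec hz, hh.dHol_symm hz]

theorem chernSymbol_bilinear {z : EE n} (hz : z ∈ Ω) : IsBilinearMap ℝ (chernSymbol h z) where
  add_left := hh.chernSymbol_add_left hz
  add_right v w w' := by
    simp only [hh.chernSymbol_symm hz v, hh.chernSymbol_add_left hz]
  smul_left c v w := by
    have := hh.chernSymbol_smul_left hz c v w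
    simpa using this
  smul_right c v w := by
    have := hh.chernSymbol_smul_left hz c w v
    simp only [hh.chernSymbol_symm hz v]
    simpa using this

theorem chernSymbol_zero_left {z : EE n} (hz : z ∈ Ω) (w : EE n) : chernSymbol h z 0 w = 0 := by
  simpa using hh.chernSymbol_smul_left hz 0 0 w

theorem contDiffAt_chernSymbol {z : EE n} (hz : z ∈ Ω) (v w : EE n) :
    ContDiffAt ℝ ∞ (fun z => chernSymbol h z v w) z := by
  refine contDiffAt_of_linear_eq (A := fun z => (hh.components z).restrictScalars ℝ)
    (y := fun z j => dHol v (fun z' => h z' w (EuclideanSpace.single j 1)) z) (fun γ => ?_)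
    (hh.components_injective hz) ?_ ?_
  · exact contDiffAt_pi.mpr fun j => hh.smooth z hz _ _
  · exact contDiffAt_pi.mpr fun j => contDiffAt_dHol (hh.smooth z hz _ _) v
  · filter_upwards [hh.isOpen.mem_nhds hz] with z' hz'
    ext j
    exact hh.chernSymbol_spec hz' v w _

end IsKahlerOn

end SemiIsometric

/-! ### Pointwise geometry of a semi-isometric hypersurface in coordinates -/

namespace SemiIsometric

namespace LocalData

variable {n : ℕ}

/-- The data `d` is smooth and describes a semi-isometric hypersurface on `U`, with values in the
open set `Ω`, on which the metric is Kähler. -/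
structure IsGood (d : LocalData n) (U : Set (VV n)) (Ω : Set (EE n)) : Prop where
  metric : IsKahlerOn d.h Ω
  isOpen : IsOpen U
  maps : ∀ u ∈ U, d.F u ∈ Ω
  smooth : ∀ u ∈ U, ContDiffAt ℝ ∞ d.F u
  theta_add : ∀ u v w, d.θ u (v + w) = d.θ u v + d.θ u w
  theta_smul : ∀ (u : VV n) (c : ℝ) (v : VV n), d.θ u (c • v) = c * d.θ u v
  theta_smooth : ∀ u ∈ U, ∀ v, ContDiffAt ℝ ∞ (fun u => d.θ u v) u
  semi : ∀ u ∈ U, d.IsSemiIsometricAt u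

variable (d : LocalData n)

/-! ### Linearity -/

theorem push_add (u : VV n) (Z W : VC n) : d.push u (Z + W) = d.push u Z + d.push u W :=
  dirD_add_left _ _ _ _

theorem push_sub (u : VV n) (Z W : VC n) : d.push u (Z - W) = d.push u Z - d.push u W :=
  dirD_sub_left _ _ _ _

theorem push_smul (u : VV n) (c : ℂ) (Z : VC n) : d.push u (c • Z) = c • d.push u Z :=
  dirD_smul_left _ _ _ _

@[simp] theorem push_zero (u : VV n) : d.push u 0 = 0 := dirD_zero_left _ _

theorem push_ofRealVec (u v : VV n) : d.push u (ofRealVec v) = fderiv ℝ d.F u v :=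
  dirD_ofRealVec _ _ _

theorem thetaC_add (u : VV n) (Z W : VC n) :
    d.thetaC u (Z + W) = d.thetaC u Z + d.thetaC u W := by
  simp [thetaC, add_mul, Finset.sum_add_distrib]

theorem thetaC_sub (u : VV n) (Z W : VC n) :
    d.thetaC u (Z - W) = d.thetaC u Z - d.thetaC u W := by
  simp [thetaC, sub_mul, Finset.sum_sub_distrib]

theorem thetaC_smul (u : VV n) (c : ℂ) (Z : VC n) : d.thetaC u (c • Z) = c * d.thetaC u Z := by
  simp [thetaC, Finset.mul_sum, mul_assoc]

theorem thetaC_conjVec (u : VV n) (Z : VC n) :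
    d.thetaC u (conjVec Z) = starRingEnd ℂ (d.thetaC u Z) := by
  simp [thetaC, map_sum]

theorem dTheta_swap (u v w : VV n) : d.dTheta u w v = - d.dTheta u v w := by
  simp [dTheta]

/-- The `(1,0)`-part of the image of the Reeb field. -/
noncomputable def normal (u : VV n) : EE n := d.push u (d.reebC u)

/-- The pulled back Chern derivative of a field of `(1,0)`-vectors along `F`. -/
noncomputable def covD (Z : VC n) (S : VV n → EE n) (u : VV n) : EE n :=
  dirD Z S u + chernSymbol d.h (d.F u) (d.push u Z) (S u)

namespace IsGood

variable {d} {U : Set (VV n)} {Ω : Set (EE n)} (hd : d.IsGood U Ω)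
include hd

theorem mem_nhds {u : VV n} (hu : u ∈ U) : ∀ᶠ u' in 𝓝 u, u' ∈ U := hd.isOpen.mem_nhds hu

theorem differentiableAt {u : VV n} (hu : u ∈ U) : DifferentiableAt ℝ d.F u :=
  (hd.smooth u hu).differentiableAt (by simp)

theorem contDiffAt_push {u : VV n} (hu : u ∈ U) {Z : VV n → VC n} (hZ : ContDiffAt ℝ ∞ Z u) :
    ContDiffAt ℝ ∞ (fun u => d.push u (Z u)) u := contDiffAt_dirD hZ (hd.smooth u hu)

theorem isT10_iff {u : VV n} (hu : u ∈ U) {Z : VC n} :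
    d.IsT10 u Z ↔ d.push u (conjVec Z) = 0 := by
  rw [IsT10, dirD_conjVec (hd.differentiableAt hu), conjVec_eq_zero]
  rfl

theorem isT10_add {u : VV n} (hu : u ∈ U) {Z W : VC n} (hZ : d.IsT10 u Z) (hW : d.IsT10 u W) :
    d.IsT10 u (Z + W) := by
  rw [hd.isT10_iff hu] at *
  rw [conjVec_add, push_add, hZ, hW, add_zero]

theorem isT10_sub {u : VV n} (hu : u ∈ U) {Z W : VC n} (hZ : d.IsT10 u Z) (hW : d.IsT10 u W) :
    d.IsT10 u (Z - W) := by
  rw [hd.isT10_iff hu] at *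
  rw [conjVec_sub, push_sub, hZ, hW, sub_zero]

theorem isT10_smul {u : VV n} (hu : u ∈ U) (c : ℂ) {Z : VC n} (hZ : d.IsT10 u Z) :
    d.IsT10 u (c • Z) := by
  rw [hd.isT10_iff hu] at *
  rw [conjVec_smul, push_smul, hZ, smul_zero]

theorem isT10_zero {u : VV n} (hu : u ∈ U) : d.IsT10 u 0 := by
  rw [hd.isT10_iff hu, conjVec_zero, push_zero]

/-- A real vector killed by dF vanishes. Applied to the real parts of Z and of iZ, this recovers
both the real and the imaginary part of Z. -/
theorem eq_zero_of_push {u : VV n} (hu : u ∈ U) {Z : VC n} (h₁ : d.push u Z = 0)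
    (h₂ : d.push u (conjVec Z) = 0) : Z = 0 := by
  have key : ∀ W : VC n, d.push u W = 0 → d.push u (conjVec W) = 0 → reVec W = 0 := by
    intro W h₁ h₂
    apply (hd.semi u hu).immersion
    rw [map_zero, ← push_ofRealVec, ofRealVec_reVec, push_smul, push_add, h₁, h₂, add_zero,
      smul_zero]
  have a := key Z h₁ h₂
  have b := key (Complex.I • Z) (by rw [push_smul, h₁, smul_zero])
    (by rw [conjVec_smul, push_smul, h₂, smul_zero])
  ext j
  have a' := congrArg (fun v => v j) a
  have b' := congrArg (fun v => v j) b
  simp at a' b'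
  exact Complex.ext a' b'

theorem isT10_ext {u : VV n} (hu : u ∈ U) {Z W : VC n} (hZ : d.IsT10 u Z) (hW : d.IsT10 u W)
    (h : d.push u Z = d.push u W) : Z = W := by
  rw [← sub_eq_zero]
  refine hd.eq_zero_of_push hu (by rw [push_sub, h, sub_self]) ?_
  exact (hd.isT10_iff hu).mp (hd.isT10_sub hu hZ hW)

/-- Z solves the smooth linear system with unknown W given by `push W` and `push (conjVec W)`, which
is injective by `eq_zero_of_push`. The second component is conjugate-linear, so the system is only
real-linear. -/
theorem contDiffAt_of_push {u : VV n} (hu : u ∈ U) {Z : VV n → VC n}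
    (h₁ : ContDiffAt ℝ ∞ (fun u => d.push u (Z u)) u)
    (h₂ : ∀ᶠ u' in 𝓝 u, d.IsT10 u' (Z u')) : ContDiffAt ℝ ∞ Z u := by
  let A : VV n → VC n →ₗ[ℝ] EE n × EE n := fun u' =>
    { toFun := fun W => (d.push u' W, d.push u' (conjCLM _ W))
      map_add' := fun W W' => by rw [map_add, push_add, push_add]; rfl
      map_smul' := fun c W => by
        have : ∀ W : VC n, d.push u' (c • W) = c • d.push u' W := fun W => by
          have := d.push_smul u' c W
          simpa using this
        rw [map_smul, this, this]
        rfl }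
  refine contDiffAt_of_linear_eq (A := A) (y := fun u' => (d.push u' (Z u'), 0)) (fun v => ?_) ?_
    (h₁.prodMk contDiffAt_const) ?_
  · exact (hd.contDiffAt_push hu contDiffAt_const).prodMk
      (hd.contDiffAt_push hu contDiffAt_const)
  · rw [← LinearMap.ker_eq_bot, LinearMap.ker_eq_bot']
    intro W hW
    exact hd.eq_zero_of_push hu (congrArg Prod.fst hW) (congrArg Prod.snd hW)
  · filter_upwards [h₂, hd.mem_nhds hu] with u' h h'
    exact Prod.ext rfl ((hd.isT10_iff h').mp h)

/-! ### The contact form -/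

theorem theta_eq_sum (u v : VV n) : d.θ u v = ∑ a, v a * d.θ u (coordVec a) := by
  let L : VV n →ₗ[ℝ] ℝ :=
    { toFun := d.θ u, map_add' := hd.theta_add u, map_smul' := hd.theta_smul u }
  have : L v = ∑ a, v a * L (coordVec a) := by
    conv_lhs => rw [← sum_smul_coordVec v, map_sum]
    simp
  exact this

theorem thetaC_ofRealVec (u v : VV n) : d.thetaC u (ofRealVec v) = (d.θ u v : ℂ) := by
  rw [hd.theta_eq_sum u v, thetaC]
  push_cast
  rfl

/-- The contact condition speaks of real parts only; applying it to Z and to iZ kills both parts of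
θ(Z). -/
theorem thetaC_isT10 {u : VV n} (hu : u ∈ U) {Z : VC n} (hZ : d.IsT10 u Z) :
    d.thetaC u Z = 0 := by
  have key : ∀ W : VC n, d.IsT10 u W → (d.thetaC u W).re = 0 := by
    intro W hW
    have h0 : d.θ u (reVec W) = 0 := ((hd.semi u hu).contact _).mpr ⟨W, hW, rfl⟩
    have h1 := hd.thetaC_ofRealVec u (reVec W)
    rw [h0, ofRealVec_reVec, thetaC_smul, thetaC_add, thetaC_conjVec, Complex.add_conj] at h1
    have h2 := congrArg Complex.re h1
    simpa using h2
  refine Complex.ext (key Z hZ) ?_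
  have := key _ (hd.isT10_smul hu Complex.I hZ)
  simpa [thetaC_smul] using this

theorem dTheta_eq {u : VV n} (hu : u ∈ U) (v w : VV n) :
    (d.dTheta u v w : ℂ) = Complex.I * (d.h (d.F u) (fderiv ℝ d.F u v) (fderiv ℝ d.F u w)
      - d.h (d.F u) (fderiv ℝ d.F u w) (fderiv ℝ d.F u v)) := by
  rw [(hd.semi u hu).semi_isometric, fundForm,
    hd.metric.conj_symm _ (fderiv ℝ d.F u v) (fderiv ℝ d.F u w)]
  apply Complex.ext <;> simp
  ring

theorem dThetaC_eq {u : VV n} (hu : u ∈ U) (Z W : VC n) :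
    d.dThetaC u Z W = Complex.I * (d.h (d.F u) (d.push u Z) (d.push u (conjVec W))
      - d.h (d.F u) (d.push u W) (d.push u (conjVec Z))) := by
  simp only [push, dirD, hd.metric.sum_left, hd.metric.sum_right, hd.metric.smul_left,
    hd.metric.smul_right, conjVec_apply, Complex.conj_conj]
  rw [Finset.sum_comm (f := fun a b => W a * _), ← Finset.sum_sub_distrib, dThetaC,
    Finset.mul_sum]
  refine Finset.sum_congr rfl fun a _ => ?_
  rw [← Finset.sum_sub_distrib, Finset.mul_sum]
  refine Finset.sum_congr rfl fun b _ => ?_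
  rw [hd.dTheta_eq hu]
  ring

theorem levi_eq {u : VV n} (hu : u ∈ U) (Z : VC n) {W : VC n} (hW : d.IsT10 u W) :
    d.levi u Z W = d.h (d.F u) (d.push u Z) (d.push u W) := by
  rw [levi, hd.dThetaC_eq hu, conjVec_conjVec, (hd.isT10_iff hu).mp hW, hd.metric.zero_left,
    sub_zero, ← mul_assoc, neg_mul, Complex.I_mul_I, neg_neg, one_mul]

theorem levi_self_ne_zero {u : VV n} (hu : u ∈ U) {Z : VC n} (hZ : d.IsT10 u Z) (h0 : Z ≠ 0) :
    d.levi u Z Z ≠ 0 := by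
  rw [hd.levi_eq hu Z hZ, Ne, hd.metric.self_eq_zero (hd.maps u hu)]
  exact fun h => h0 (hd.eq_zero_of_push hu h ((hd.isT10_iff hu).mp hZ))

theorem thetaC_bracket {u : VV n} (hu : u ∈ U) {X Y : VV n → VC n} (hX : DifferentiableAt ℝ X u)
    (hY : DifferentiableAt ℝ Y u) :
    d.thetaC u (bracket X Y u) = dirD (X u) (fun u => d.thetaC u (Y u)) u
      - dirD (Y u) (fun u => d.thetaC u (X u)) u - d.dThetaC u (X u) (Y u) := by
  have hre : ∀ v, DifferentiableAt ℝ (fun u => d.θ u v) u := fun v =>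
    (hd.theta_smooth u hu v).differentiableAt (by simp)
  have hθ : ∀ v, HasFDerivAt (fun u => (d.θ u v : ℂ))
      (Complex.ofRealCLM.comp (fderiv ℝ (fun u => d.θ u v) u)) u := fun v =>
    Complex.ofRealCLM.hasFDerivAt.comp u (hre v).hasFDerivAt
  have key : ∀ X Y : VV n → VC n, DifferentiableAt ℝ Y u →
      dirD (X u) (fun u => d.thetaC u (Y u)) u = d.thetaC u (dirD (X u) Y u)
        + ∑ a, ∑ b, X u a * Y u b
            * (fderiv ℝ (fun u => d.θ u (coordVec b)) u (coordVec a) : ℂ) := by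
    intro X Y hY
    simp only [thetaC, ← smul_eq_mul (Y _ _)]
    rw [dirD_sum _ (fun a _ => (differentiableAt_coord hY a).fun_smul
      (hθ (coordVec a)).differentiableAt)]
    simp only [dirD_smul (differentiableAt_coord hY _) (hθ _).differentiableAt, dirD_coord hY]
    rw [Finset.sum_add_distrib, add_comm, Finset.sum_comm (f := fun a b => X u a * _ * _)]
    congr 1
    refine Finset.sum_congr rfl fun a _ => ?_
    rw [dirD, Finset.smul_sum]
    refine Finset.sum_congr rfl fun b _ => ?_
    rw [(hθ _).fderiv]
    simp
    ring
  rw [key X Y hY, key Y X hX, bracket, thetaC_sub,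
    Finset.sum_comm (f := fun a b => Y u a * _ * _)]
  have : d.dThetaC u (X u) (Y u)
      = ∑ a, ∑ b, X u a * Y u b * (fderiv ℝ (fun u => d.θ u (coordVec b)) u (coordVec a) : ℂ)
        - ∑ a, ∑ b, Y u b * X u a
            * (fderiv ℝ (fun u => d.θ u (coordVec a)) u (coordVec b) : ℂ) := by
    simp only [dThetaC, ← Finset.sum_sub_distrib]
    refine Finset.sum_congr rfl fun a _ => Finset.sum_congr rfl fun b _ => ?_
    rw [dTheta]
    push_cast
    ring
  rw [this]
  ring

/-! ### The Reeb field -/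

theorem fderiv_reVec {u : VV n} (hu : u ∈ U) {Z : VC n} (hZ : d.IsT10 u Z) :
    fderiv ℝ d.F u (reVec Z) = (1 / 2 : ℂ) • d.push u Z := by
  rw [← push_ofRealVec, ofRealVec_reVec, push_smul, push_add, (hd.isT10_iff hu).mp hZ, add_zero]

/-- Pairing v with Re Z under ω controls only an imaginary part of h; replacing Z by iZ supplies the
real part. -/
theorem h_push_eq_zero_of_dTheta {u : VV n} (hu : u ∈ U) {v : VV n}
    (hv : ∀ w, d.dTheta u v w = 0) {Z : VC n} (hZ : d.IsT10 u Z) :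
    d.h (d.F u) (fderiv ℝ d.F u v) (d.push u Z) = 0 := by
  have key : ∀ W, d.IsT10 u W → (d.h (d.F u) (fderiv ℝ d.F u v) (d.push u W)).im = 0 := by
    intro W hW
    have := hv (reVec W)
    rw [(hd.semi u hu).semi_isometric, fundForm, hd.fderiv_reVec hu hW,
      hd.metric.smul_right] at this
    simpa [Complex.mul_im] using this
  refine Complex.ext ?_ (key Z hZ)
  have := key _ (hd.isT10_smul hu Complex.I hZ)
  rw [push_smul, hd.metric.smul_right] at this
  simpa using this

/-- Nondegeneracy of dθ on the contact distribution: v = Re Z is then h-orthogonal to Z itself. This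
gives existence and uniqueness of the Reeb vector. -/
theorem eq_zero_of_dTheta {u : VV n} (hu : u ∈ U) {v : VV n} (h0 : d.θ u v = 0)
    (hv : ∀ w, d.dTheta u v w = 0) : v = 0 := by
  obtain ⟨Z, hZ, rfl⟩ := ((hd.semi u hu).contact v).mp h0
  have := hd.h_push_eq_zero_of_dTheta hu hv hZ
  rw [hd.fderiv_reVec hu hZ, hd.metric.smul_left, mul_eq_zero, hd.metric.self_eq_zero
    (hd.maps u hu)] at this
  apply (hd.semi u hu).immersion
  rw [hd.fderiv_reVec hu hZ, map_zero, this.resolve_left (by norm_num), smul_zero]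

theorem dTheta_eq_sum_right {u : VV n} (hu : u ∈ U) (v w : VV n) :
    d.dTheta u v w = ∑ b, w b * d.dTheta u v (coordVec b) := by
  have hB := hd.metric.bilinear (d.F u)
  let L : VV n →ₗ[ℝ] ℝ :=
    { toFun := fun w => d.dTheta u v w
      map_add' := fun w w' => by
        simp only [(hd.semi u hu).semi_isometric, fundForm, map_add, hB.add_right, Complex.add_im]
        ring
      map_smul' := fun c w => by
        simp only [(hd.semi u hu).semi_isometric, fundForm, map_smul, hB.smul_right]
        simp
        ring }
  have : L w = ∑ b, w b * L (coordVec b) := by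
    conv_lhs => rw [← sum_smul_coordVec w, map_sum]
    simp
  exact this

/-- A skew-symmetric matrix of odd size 2n + 1 is singular, so dθ has a nonzero kernel vector. By
`eq_zero_of_dTheta`, θ does not vanish on it, and it can be normalized. -/
theorem exists_reeb {u : VV n} (hu : u ∈ U) : ∃ T, d.θ u T = 1 ∧ ∀ v, d.dTheta u T v = 0 := by
  let A : Matrix (Fin (2 * n + 1)) (Fin (2 * n + 1)) ℝ := fun b a =>
    d.dTheta u (coordVec b) (coordVec a)
  have hA : A.transpose = -A := by
    ext a b
    exact d.dTheta_swap _ _ _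
  have hdet : A.det = 0 := by
    have h := A.det_transpose
    rw [hA, Matrix.det_neg, Fintype.card_fin, Odd.neg_one_pow ⟨n, rfl⟩] at h
    linarith
  obtain ⟨v, hv0, hv⟩ := Matrix.exists_mulVec_eq_zero_iff.mpr hdet
  let T : VV n := WithLp.toLp 2 v
  have hT0 : T ≠ 0 := fun h => hv0 (by ext a; exact congrArg (fun w : VV n => w a) h)
  have hT1 : ∀ b, d.dTheta u (coordVec b) T = 0 := by
    intro b
    rw [hd.dTheta_eq_sum_right hu]
    have := congrFun hv b
    simp only [Matrix.mulVec, dotProduct, Pi.zero_apply] at this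
    rw [← this]
    exact Finset.sum_congr rfl fun a _ => mul_comm _ _
  have hT : ∀ w, d.dTheta u T w = 0 := by
    intro w
    rw [hd.dTheta_eq_sum_right hu]
    refine Finset.sum_eq_zero fun b _ => ?_
    rw [d.dTheta_swap, hT1, neg_zero, mul_zero]
  have hθ : d.θ u T ≠ 0 := fun h => hT0 (hd.eq_zero_of_dTheta hu h hT)
  refine ⟨(d.θ u T)⁻¹ • T, by rw [hd.theta_smul, inv_mul_cancel₀ hθ], fun v => ?_⟩
  have hB := hd.metric.bilinear (d.F u)
  have h1 := hT v
  rw [(hd.semi u hu).semi_isometric, fundForm] at h1 ⊢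
  rw [map_smul, hB.smul_left, Complex.smul_im, smul_eq_mul]
  linear_combination (d.θ u T)⁻¹ * h1

theorem theta_reeb {u : VV n} (hu : u ∈ U) : d.θ u (d.reeb u) = 1 :=
  (Classical.epsilon_spec (hd.exists_reeb hu)).1

theorem dTheta_reeb {u : VV n} (hu : u ∈ U) (v : VV n) : d.dTheta u (d.reeb u) v = 0 :=
  (Classical.epsilon_spec (hd.exists_reeb hu)).2 v

theorem thetaC_reebC {u : VV n} (hu : u ∈ U) : d.thetaC u (d.reebC u) = 1 := by
  rw [reebC, hd.thetaC_ofRealVec, hd.theta_reeb hu, Complex.ofReal_one]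

theorem contDiffAt_reeb {u : VV n} (hu : u ∈ U) : ContDiffAt ℝ ∞ d.reeb u := by
  have hB := hd.metric.bilinear
  -- Im h replaces dθ = -2 Im h: its linearity in v is available at every u', as the family A
  -- requires, while the identity with dθ is known only on U.
  let A : VV n → VV n →ₗ[ℝ] ℝ × (Fin (2 * n + 1) → ℝ) := fun u' =>
    { toFun := fun v => (d.θ u' v, fun b =>
        (d.h (d.F u') (fderiv ℝ d.F u' v) (fderiv ℝ d.F u' (coordVec b))).im)
      map_add' := fun v w => by
        ext
        · exact hd.theta_add _ _ _
        · simp [(hB _).add_left]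
      map_smul' := fun c v => by
        ext
        · exact hd.theta_smul _ _ _
        · simp [(hB _).smul_left] }
  have hF := (hd.smooth u hu).fderiv_right (m := ∞) (by simp)
  refine contDiffAt_of_linear_eq (A := A) (y := fun _ => (1, 0)) (fun v => ?_) ?_
    contDiffAt_const ?_
  · refine (hd.theta_smooth u hu v).prodMk (contDiffAt_pi.mpr fun b => ?_)
    refine Complex.imCLM.contDiff.contDiffAt.comp u ?_
    refine contDiffAt_bilinear (b := fun u => d.h (d.F u)) (.of_forall fun u' => hB _)
      (fun v w => ?_) (hF.clm_apply contDiffAt_const) (hF.clm_apply contDiffAt_const)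
    exact (hd.metric.smooth _ (hd.maps u hu) v w).comp u (hd.smooth u hu)
  · rw [← LinearMap.ker_eq_bot, LinearMap.ker_eq_bot']
    intro v hv
    refine hd.eq_zero_of_dTheta hu (congrArg Prod.fst hv) fun w => ?_
    rw [hd.dTheta_eq_sum_right hu]
    refine Finset.sum_eq_zero fun b _ => ?_
    have : (d.h (d.F u) (fderiv ℝ d.F u v) (fderiv ℝ d.F u (coordVec b))).im = 0 :=
      congrFun (congrArg Prod.snd hv) b
    rw [(hd.semi u hu).semi_isometric, fundForm, this, mul_zero, mul_zero]
  · filter_upwards [hd.mem_nhds hu] with u' hu'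
    refine Prod.ext (hd.theta_reeb hu') ?_
    ext b
    have := hd.dTheta_reeb hu' (coordVec b)
    rw [(hd.semi u' hu').semi_isometric, fundForm] at this
    change (d.h (d.F u') (fderiv ℝ d.F u' _) (fderiv ℝ d.F u' (coordVec b))).im = 0
    linarith

theorem contDiffAt_reebC {u : VV n} (hu : u ∈ U) : ContDiffAt ℝ ∞ d.reebC u :=
  (ofRealCLM _).contDiff.contDiffAt.comp u (hd.contDiffAt_reeb hu)

theorem contDiffAt_normal {u : VV n} (hu : u ∈ U) : ContDiffAt ℝ ∞ d.normal u :=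
  hd.contDiffAt_push hu (hd.contDiffAt_reebC hu)

theorem h_normal_push {u : VV n} (hu : u ∈ U) {Z : VC n} (hZ : d.IsT10 u Z) :
    d.h (d.F u) (d.normal u) (d.push u Z) = 0 := by
  rw [normal, reebC, push_ofRealVec]
  exact hd.h_push_eq_zero_of_dTheta hu (hd.dTheta_reeb hu) hZ

theorem h_push_normal {u : VV n} (hu : u ∈ U) {Z : VC n} (hZ : d.IsT10 u Z) :
    d.h (d.F u) (d.push u Z) (d.normal u) = 0 := by
  rw [hd.metric.conj_symm, hd.h_normal_push hu hZ, map_zero]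

theorem normal_ne_zero {u : VV n} (hu : u ∈ U) : d.normal u ≠ 0 := by
  intro h
  rw [normal, reebC, push_ofRealVec] at h
  have h0 : d.reeb u = 0 := (hd.semi u hu).immersion (by rw [h, map_zero])
  have h1 := hd.theta_reeb hu
  rw [h0] at h1
  have h2 := hd.theta_smul u 0 0
  rw [zero_smul, zero_mul] at h2
  linarith

theorem h_normal_ne_zero {u : VV n} (hu : u ∈ U) :
    d.h (d.F u) (d.normal u) (d.normal u) ≠ 0 := by
  rw [Ne, hd.metric.self_eq_zero (hd.maps u hu)]
  exact hd.normal_ne_zero hu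

/-! ### The projection onto the CR bundle -/

theorem proj10_spec {u : VV n} (hu : u ∈ U) (Y : VC n) :
    d.IsT10 u (d.proj10 u Y) ∧
      d.IsT10 u (conjVec (Y - d.proj10 u Y - d.thetaC u Y • d.reebC u)) := by
  suffices h : ∃ Z, d.IsT10 u Z ∧ d.IsT10 u (conjVec (Y - Z - d.thetaC u Y • d.reebC u)) from
    Classical.epsilon_spec h
  set Y' := Y - d.thetaC u Y • d.reebC u with hY'
  have h0 : d.thetaC u Y' = 0 := by
    rw [hY', thetaC_sub, thetaC_smul, hd.thetaC_reebC hu, mul_one, sub_self]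
  have key : ∀ W : VC n, d.thetaC u W = 0 → ∃ Z, d.IsT10 u Z ∧ W + conjVec W = Z + conjVec Z := by
    intro W hW
    have h1 := hd.thetaC_ofRealVec u (reVec W)
    rw [ofRealVec_reVec, thetaC_smul, thetaC_add, thetaC_conjVec, hW] at h1
    have h2 : d.θ u (reVec W) = 0 := by
      have : ((d.θ u (reVec W) : ℝ) : ℂ) = 0 := by rw [← h1]; simp
      exact_mod_cast this
    obtain ⟨Z, hZ, hZW⟩ := ((hd.semi u hu).contact _).mp h2
    refine ⟨Z, hZ, ?_⟩
    have h3 := congrArg ofRealVec hZW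
    rw [ofRealVec_reVec, ofRealVec_reVec] at h3
    exact (smul_right_injective _ (by norm_num : (1 / 2 : ℂ) ≠ 0) h3).symm
  -- The real parts of Y' and iY' lie in the contact distribution, hence are Re Z₁ and Re Z₂.
  -- Solving for Y' gives the (1,0)-part (Z₁ - iZ₂)/2 and the (0,1)-part conjugate to (Z₁ + iZ₂)/2.
  obtain ⟨Z₁, hZ₁, e₁⟩ := key Y' h0
  obtain ⟨Z₂, hZ₂, e₂⟩ := key (Complex.I • Y') (by rw [thetaC_smul, h0, mul_zero])
  refine ⟨(1 / 2 : ℂ) • (Z₁ - Complex.I • Z₂),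
    hd.isT10_smul hu _ (hd.isT10_sub hu hZ₁ (hd.isT10_smul hu _ hZ₂)), ?_⟩
  have : Y - (1 / 2 : ℂ) • (Z₁ - Complex.I • Z₂) - d.thetaC u Y • d.reebC u
      = conjVec ((1 / 2 : ℂ) • (Z₁ + Complex.I • Z₂)) := by
    rw [sub_right_comm, ← hY', sub_eq_iff_eq_add, conjVec_smul, conjVec_add, conjVec_smul]
    ext a
    have a₁ := congrArg (fun v : VC n => v a) e₁
    have a₂ := congrArg (fun v : VC n => v a) e₂
    have h2 : starRingEnd ℂ 2 = 2 := Complex.conj_ofNat 2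
    simp [h2] at a₁ a₂ ⊢
    linear_combination (1 / 2 : ℂ) * a₁ - (1 / 2 : ℂ) * Complex.I * a₂
      + (1 / 2 : ℂ) * (Y' a - starRingEnd ℂ (Y' a)) * Complex.I_mul_I
  rw [this, conjVec_conjVec]
  exact hd.isT10_smul hu _ (hd.isT10_add hu hZ₁ (hd.isT10_smul hu _ hZ₂))

theorem isT10_proj10 {u : VV n} (hu : u ∈ U) (Y : VC n) : d.IsT10 u (d.proj10 u Y) :=
  (hd.proj10_spec hu Y).1

theorem push_proj10 {u : VV n} (hu : u ∈ U) (Y : VC n) :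
    d.push u (d.proj10 u Y) = d.push u Y - d.thetaC u Y • d.normal u := by
  have h := (hd.isT10_iff hu).mp (hd.proj10_spec hu Y).2
  rw [conjVec_conjVec, push_sub, push_sub, push_smul] at h
  rw [sub_sub, sub_eq_zero] at h
  rw [h, normal, add_sub_cancel_right]

theorem proj10_eq {u : VV n} (hu : u ∈ U) {Y Z : VC n} (hZ : d.IsT10 u Z)
    (h : d.push u Z = d.push u Y - d.thetaC u Y • d.normal u) : d.proj10 u Y = Z :=
  hd.isT10_ext hu (hd.isT10_proj10 hu Y) hZ (by rw [hd.push_proj10 hu, h])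

theorem proj10_of_isT10 {u : VV n} (hu : u ∈ U) {Z : VC n} (hZ : d.IsT10 u Z) :
    d.proj10 u Z = Z :=
  hd.proj10_eq hu hZ (by rw [hd.thetaC_isT10 hu hZ, zero_smul, sub_zero])

/-- The image of Y differs from θ(Y) N by the image of a (1,0)-vector, which is orthogonal to N. -/
theorem h_push_normal_eq {u : VV n} (hu : u ∈ U) (Y : VC n) :
    d.h (d.F u) (d.push u Y) (d.normal u)
      = d.thetaC u Y * d.h (d.F u) (d.normal u) (d.normal u) := by
  have h := hd.h_push_normal hu (hd.isT10_proj10 hu Y)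
  rw [hd.push_proj10 hu, hd.metric.sub_left, hd.metric.smul_left, sub_eq_zero] at h
  exact h

theorem contDiffAt_thetaC {u : VV n} (hu : u ∈ U) {Y : VV n → VC n} (hY : ContDiffAt ℝ ∞ Y u) :
    ContDiffAt ℝ ∞ (fun u => d.thetaC u (Y u)) u :=
  ContDiffAt.sum fun a _ => (contDiffAt_coord hY a).mul
    (Complex.ofRealCLM.contDiff.contDiffAt.comp u (hd.theta_smooth u hu _))

theorem contDiffAt_proj10 {u : VV n} (hu : u ∈ U) {Y : VV n → VC n} (hY : ContDiffAt ℝ ∞ Y u) :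
    ContDiffAt ℝ ∞ (fun u => d.proj10 u (Y u)) u := by
  refine hd.contDiffAt_of_push hu ?_ ((hd.mem_nhds hu).mono fun u' hu' => hd.isT10_proj10 hu' _)
  refine ContDiffAt.congr_of_eventuallyEq ?_
    ((hd.mem_nhds hu).mono fun u' hu' => hd.push_proj10 hu' (Y u'))
  exact (hd.contDiffAt_push hu hY).sub
    ((hd.contDiffAt_thetaC hu hY).smul (hd.contDiffAt_normal hu))

/-- The image of `T^{1,0}M` is the orthogonal complement of the normal. -/
theorem exists_isT10_push_eq {u : VV n} (hu : u ∈ U) {w : EE n}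
    (hw : d.h (d.F u) w (d.normal u) = 0) : ∃ Z, d.IsT10 u Z ∧ d.push u Z = w := by
  set N := d.normal u with hN
  have hNre : (d.h (d.F u) N N).re ≠ 0 := (hd.metric.pos _ (hd.maps u hu) _
    (hd.normal_ne_zero hu)).ne'
  have him : ∀ v, (d.h (d.F u) (fderiv ℝ d.F u v) N).im = 0 := by
    intro v
    rw [← push_ofRealVec, hd.h_push_normal_eq hu, hd.thetaC_ofRealVec]
    simp [hd.metric.im_self]
  -- The image of dF pairs with N in real numbers while iN pairs in imaginary ones, so iN is
  -- transverse to it. Both sides have real dimension 2n + 2, hence Φ is bijective, and vectors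
  -- orthogonal to N have no iN-component.
  let Φ : VV n × ℝ →ₗ[ℝ] EE n :=
    (fderiv ℝ d.F u).toLinearMap.coprod (LinearMap.toSpanSingleton ℝ (EE n) (Complex.I • N))
  have hΦ : ∀ v t, Φ (v, t) = fderiv ℝ d.F u v + ((t : ℂ) * Complex.I) • N := by
    intro v t
    simp [Φ, mul_smul]
  have himΦ : ∀ v t, (d.h (d.F u) (Φ (v, t)) N).im = t * (d.h (d.F u) N N).re := by
    intro v t
    rw [hΦ, hd.metric.add_left, hd.metric.smul_left, Complex.add_im, him]
    simp
  have hinj : Function.Injective Φ := by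
    rw [← LinearMap.ker_eq_bot, LinearMap.ker_eq_bot']
    rintro ⟨v, t⟩ h
    have h1 := himΦ v t
    rw [h, hd.metric.zero_left, Complex.zero_im, eq_comm, mul_eq_zero] at h1
    have ht := h1.resolve_right hNre
    rw [hΦ, ht, Complex.ofReal_zero, zero_mul, zero_smul, add_zero] at h
    rw [ht, (hd.semi u hu).immersion (h.trans (map_zero _).symm)]
    rfl
  have hsurj : Function.Surjective Φ := by
    refine (LinearMap.injective_iff_surjective_of_finrank_eq_finrank ?_).mp hinj
    rw [finrank_real_of_complex]
    simp
    ring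
  have lift : ∀ w, d.h (d.F u) w N = 0 → ∃ v, fderiv ℝ d.F u v = w := by
    intro w hw
    obtain ⟨⟨v, t⟩, rfl⟩ := hsurj w
    have h1 := himΦ v t
    rw [hw, Complex.zero_im, eq_comm, mul_eq_zero] at h1
    exact ⟨v, by simp [hΦ, h1.resolve_right hNre]⟩
  obtain ⟨v, hv⟩ := lift w hw
  obtain ⟨v', hv'⟩ := lift (Complex.I • w) (by rw [hd.metric.smul_left, hw, mul_zero])
  -- With dF(v) = w and dF(v') = iw, the vector (v - iv')/2 pushes to w and its conjugate to (w +
  -- i·iw)/2 = 0, so it is of type (1,0).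
  refine ⟨(1 / 2 : ℂ) • (ofRealVec v - Complex.I • ofRealVec v'), ?_, ?_⟩
  · rw [hd.isT10_iff hu, conjVec_smul, conjVec_sub, conjVec_smul, conjVec_ofRealVec,
      conjVec_ofRealVec, push_smul, push_sub, push_smul, push_ofRealVec, push_ofRealVec, hv, hv',
      smul_smul, Complex.conj_I, neg_mul, Complex.I_mul_I, neg_neg, one_smul, sub_self, smul_zero]
  · rw [push_smul, push_sub, push_smul, push_ofRealVec, push_ofRealVec, hv, hv', smul_smul,
      Complex.I_mul_I, neg_one_smul, sub_neg_eq_add, ← two_smul ℂ, smul_smul]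
    norm_num

end IsGood
end LocalData
end SemiIsometric

/-! ### The pulled back Chern connection and its comparison with the Tanaka-Webster connection -/

namespace SemiIsometric
namespace LocalData

variable {n : ℕ} {d : LocalData n}

theorem two_le_infty : (2 : WithTop ℕ∞) ≤ ∞ :=
  WithTop.coe_le_coe.mpr (le_top : (2 : ℕ∞) ≤ ⊤)

theorem covD_add_left {U : Set (VV n)} {Ω : Set (EE n)} (hd : d.IsGood U Ω) {u : VV n}
    (hu : u ∈ U) (Z W : VC n) (S : VV n → EE n) :
    d.covD (Z + W) S u = d.covD Z S u + d.covD W S u := by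
  simp only [covD, dirD_add_left, push_add, hd.metric.chernSymbol_add_left (hd.maps u hu)]
  abel

theorem covD_congr {S S' : VV n → EE n} {u : VV n} (h : S =ᶠ[𝓝 u] S') (Z : VC n) :
    d.covD Z S u = d.covD Z S' u := by
  rw [covD, covD, dirD_congr h, h.self_of_nhds]

theorem conjVec_bracket {X Y : VV n → VC n} {u : VV n} (hX : DifferentiableAt ℝ X u)
    (hY : DifferentiableAt ℝ Y u) :
    conjVec (bracket X Y u) = bracket (fun u => conjVec (X u)) (fun u => conjVec (Y u)) u := by
  simp only [bracket]
  rw [dirD_conjVec hX, dirD_conjVec hY, conjVec_sub, conjVec_conjVec, conjVec_conjVec]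

theorem contDiffAt_bracket {X Y : VV n → VC n} {u : VV n} (hX : ContDiffAt ℝ ∞ X u)
    (hY : ContDiffAt ℝ ∞ Y u) : ContDiffAt ℝ ∞ (bracket X Y) u :=
  (contDiffAt_dirD hX hY).sub (contDiffAt_dirD hY hX)

theorem contDiffAt_conjVec {k : ℕ} {Z : VV n → EuclideanSpace ℂ (Fin k)} {u : VV n}
    (hZ : ContDiffAt ℝ ∞ Z u) : ContDiffAt ℝ ∞ (fun u => conjVec (Z u)) u :=
  (conjCLM _).contDiff.contDiffAt.comp u hZ

/-- `W` is a smooth section of `T^{1,0}M` over `U`. -/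
structure IsField (d : LocalData n) (U : Set (VV n)) (W : VV n → VC n) : Prop where
  smooth : ∀ u ∈ U, ContDiffAt ℝ ∞ W u
  isT10 : ∀ u ∈ U, d.IsT10 u (W u)

namespace IsGood

variable {U : Set (VV n)} {Ω : Set (EE n)} (hd : d.IsGood U Ω)
include hd

/-! ### The pulled back Chern connection -/

theorem covD_smul {u : VV n} (hu : u ∈ U) {c : VV n → ℂ} {S : VV n → EE n}
    (hc : DifferentiableAt ℝ c u) (hS : DifferentiableAt ℝ S u) (Z : VC n) :
    d.covD Z (fun u => c u • S u) u = c u • d.covD Z S u + dirD Z c u • S u := by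
  have hz := hd.maps u hu
  rw [covD, covD, dirD_smul hc hS, hd.metric.chernSymbol_symm hz,
    hd.metric.chernSymbol_smul_left hz, hd.metric.chernSymbol_symm hz, smul_add]
  abel

theorem covD_sub {u : VV n} (hu : u ∈ U) {S S' : VV n → EE n}
    (hS : DifferentiableAt ℝ S u) (hS' : DifferentiableAt ℝ S' u) (Z : VC n) :
    d.covD Z (fun u => S u - S' u) u = d.covD Z S u - d.covD Z S' u := by
  have h := (hd.metric.chernSymbol_bilinear (hd.maps u hu)).add_right (d.push u Z)
    (S u - S' u) (S' u)
  rw [sub_add_cancel] at h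
  rw [covD, covD, covD, dirD_sub hS hS', h]
  abel

theorem eventually_chernSymbol_bilinear {u : VV n} (hu : u ∈ U) :
    ∀ᶠ u' in 𝓝 u, IsBilinearMap ℝ (chernSymbol d.h (d.F u')) :=
  (hd.mem_nhds hu).mono fun u' hu' => hd.metric.chernSymbol_bilinear (hd.maps u' hu')

theorem contDiffAt_chernSymbol {u : VV n} (hu : u ∈ U) (v w : EE n) :
    ContDiffAt ℝ ∞ (fun u => chernSymbol d.h (d.F u) v w) u :=
  (hd.metric.contDiffAt_chernSymbol (hd.maps u hu) v w).comp u (hd.smooth u hu)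

theorem contDiffAt_covD {u : VV n} (hu : u ∈ U) {Z : VV n → VC n} {S : VV n → EE n}
    (hZ : ContDiffAt ℝ ∞ Z u) (hS : ContDiffAt ℝ ∞ S u) :
    ContDiffAt ℝ ∞ (fun u => d.covD (Z u) S u) u :=
  (contDiffAt_dirD hZ hS).add <| contDiffAt_bilinear (hd.eventually_chernSymbol_bilinear hu)
    (hd.contDiffAt_chernSymbol hu) (hd.contDiffAt_push hu hZ) hS

theorem contDiffAt_h {u : VV n} (hu : u ∈ U) {S S' : VV n → EE n}
    (hS : ContDiffAt ℝ ∞ S u) (hS' : ContDiffAt ℝ ∞ S' u) :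
    ContDiffAt ℝ ∞ (fun u => d.h (d.F u) (S u) (S' u)) u :=
  contDiffAt_bilinear (b := fun u => d.h (d.F u))
    (.of_forall fun _ => hd.metric.bilinear _)
    (fun v w => (hd.metric.smooth _ (hd.maps u hu) v w).comp u (hd.smooth u hu)) hS hS'

/-- Metric compatibility of D. The (1,0)-derivative of h is the Γ-term in the first slot by
definition; the (0,1)-derivative is its conjugate by Hermitian symmetry and gives the Γ-term in the
second slot. -/
theorem dirD_h {u : VV n} (hu : u ∈ U) {S S' : VV n → EE n}
    (hS : DifferentiableAt ℝ S u) (hS' : DifferentiableAt ℝ S' u) (Z : VC n) :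
    dirD Z (fun u => d.h (d.F u) (S u) (S' u)) u
      = d.h (d.F u) (d.covD Z S u) (S' u) + d.h (d.F u) (S u) (d.covD (conjVec Z) S' u) := by
  have hz := hd.maps u hu
  have h1 : dirD Z (fun u => d.h (d.F u) (S u) (S' u)) u
      = dirD Z (fun u' => d.h (d.F u') (S u) (S' u)) u
        + d.h (d.F u) (dirD Z S u) (S' u) + d.h (d.F u) (S u) (dirD (conjVec Z) S' u) := by
    simp only [dirD, hd.metric.sum_left, hd.metric.sum_right, hd.metric.smul_left,
      hd.metric.smul_right, conjVec_apply, Complex.conj_conj, ← Finset.sum_add_distrib]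
    refine Finset.sum_congr rfl fun a _ => ?_
    rw [fderiv_bilinear (b := fun u => d.h (d.F u)) (.of_forall fun _ => hd.metric.bilinear _)
      (fun v w => (hd.metric.smooth _ hz v w).comp u (hd.smooth u hu)) hS hS']
    simp only [smul_eq_mul, mul_add]
  have h2 : dAnti (d.push u (conjVec Z)) (fun z => d.h z (S u) (S' u)) (d.F u)
      = d.h (d.F u) (S u) (chernSymbol d.h (d.F u) (d.push u (conjVec Z)) (S' u)) := by
    have := dHol_conj (hd.metric.differentiableAt hz (S u) (S' u)) (d.push u (conjVec Z))
    simp only [← hd.metric.conj_symm] at this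
    rw [hd.metric.conj_symm, hd.metric.chernSymbol_spec hz, this, Complex.conj_conj]
  rw [h1, dirD_comp (f := fun z => d.h z (S u) (S' u)) (hd.metric.differentiableAt hz _ _)
    (hd.differentiableAt hu), covD, covD, hd.metric.add_left, hd.metric.add_right,
    hd.metric.chernSymbol_spec hz]
  change dHol (d.push u Z) _ _ + dAnti (d.push u (conjVec Z)) _ _ + _ + _ = _
  rw [h2]
  ring

/-- D is torsion-free: the Christoffel terms cancel by the Kähler symmetry, and `dirD_bracket`
applied to F itself handles the rest. -/
theorem covD_push_sub {u : VV n} (hu : u ∈ U) {X Y : VV n → VC n}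
    (hX : DifferentiableAt ℝ X u) (hY : DifferentiableAt ℝ Y u) :
    d.covD (X u) (fun u => d.push u (Y u)) u - d.covD (Y u) (fun u => d.push u (X u)) u
      = d.push u (bracket X Y u) := by
  have h := dirD_bracket hX hY ((hd.smooth u hu).of_le two_le_infty)
  rw [push, h, covD, covD, hd.metric.chernSymbol_symm (hd.maps u hu)]
  simp only [push]
  abel

/-- The curvature of the pulled back Chern connection. -/
theorem covD_curvature {u : VV n} (hu : u ∈ U) {Z : VV n → VC n} (hZ : d.IsField U Z)
    {S : VV n → EE n} (hS : ∀ u ∈ U, ContDiffAt ℝ ∞ S u) :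
    d.covD (Z u) (fun u => d.covD (conjVec (Z u)) S u) u
      - d.covD (conjVec (Z u)) (fun u => d.covD (Z u) S u) u
      - d.covD (bracket Z (fun u => conjVec (Z u)) u) S u
      = chernCurv d.h (d.F u) (d.push u (Z u)) (d.push u (Z u)) (S u) := by
  have hz := hd.maps u hu
  have hZs := hZ.smooth u hu
  have hZb := contDiffAt_conjVec hZs
  have hP : ∀ u ∈ U, d.push u (conjVec (Z u)) = 0 := fun u hu =>
    (hd.isT10_iff hu).mp (hZ.isT10 u hu)
  have hΓ : ∀ u ∈ U, ∀ w, chernSymbol d.h (d.F u) 0 w = 0 := fun u hu w =>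
    hd.metric.chernSymbol_zero_left (hd.maps u hu) w
  have hdi : ∀ {G : Type} [NormedAddCommGroup G] [NormedSpace ℝ G] {f : VV n → G},
      ContDiffAt ℝ ∞ f u → DifferentiableAt ℝ f u := fun h => h.differentiableAt (by simp)
  -- Since Z̄ pushes to 0, D_Z̄ is plain differentiation. All terms of the curvature then cancel
  -- through brackets except the Z̄-derivative of Γ in its base point, which is the Chern curvature
  -- up to sign.
  have e₁ : (fun u => d.covD (conjVec (Z u)) S u) =ᶠ[𝓝 u] fun u => dirD (conjVec (Z u)) S u := by
    filter_upwards [hd.mem_nhds hu] with u' hu'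
    rw [covD, hP u' hu', hΓ u' hu', add_zero]
  have hPb : d.push u (bracket Z (fun u => conjVec (Z u)) u)
      = - dirD (conjVec (Z u)) (fun u => d.push u (Z u)) u := by
    rw [push, dirD_bracket (hdi hZs) (hdi hZb)
      ((hd.smooth u hu).of_le two_le_infty)]
    have : (fun u => dirD (conjVec (Z u)) d.F u) =ᶠ[𝓝 u] fun _ => 0 :=
      (hd.mem_nhds hu).mono hP
    rw [dirD_congr this, dirD_const, zero_sub]
    rfl
  have hbr := dirD_bracket (hdi hZs) (hdi hZb) ((hS u hu).of_le two_le_infty)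
  have hpush := hd.contDiffAt_push hu hZs
  have hΓd : dirD (conjVec (Z u)) (fun u => chernSymbol d.h (d.F u) (d.push u (Z u)) (S u)) u
      = dirD (conjVec (Z u))
          (fun u' => chernSymbol d.h (d.F u') (d.push u (Z u)) (S u)) u
        + chernSymbol d.h (d.F u) (dirD (conjVec (Z u)) (fun u => d.push u (Z u)) u) (S u)
        + chernSymbol d.h (d.F u) (d.push u (Z u)) (dirD (conjVec (Z u)) S u) := by
    have hB := hd.metric.chernSymbol_bilinear hz
    -- Complex linearity of Γ passes from the product rule along real coordinate directions to the
    -- complex direction Z̄.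
    have hsl : ∀ (s : Finset (Fin (2 * n + 1))) (c : Fin (2 * n + 1) → ℂ)
        (v : Fin (2 * n + 1) → EE n) w, chernSymbol d.h (d.F u) (∑ a ∈ s, c a • v a) w
          = ∑ a ∈ s, c a • chernSymbol d.h (d.F u) (v a) w := by
      intro s c v w
      classical
      induction s using Finset.induction_on with
      | empty => simpa using hΓ u hu w
      | insert a s ha ih =>
        rw [Finset.sum_insert ha, Finset.sum_insert ha, hB.add_left,
          hd.metric.chernSymbol_smul_left hz, ih]
    rw [hd.metric.chernSymbol_symm hz (d.push u (Z u)) (dirD (conjVec (Z u)) S u)]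
    simp only [dirD, hsl, ← Finset.sum_add_distrib, ← smul_add]
    refine Finset.sum_congr rfl fun a _ => ?_
    rw [fderiv_bilinear (hd.eventually_chernSymbol_bilinear hu) (hd.contDiffAt_chernSymbol hu)
      (hdi hpush) (hdi (hS u hu)),
      hd.metric.chernSymbol_symm hz (d.push u (Z u)) (fderiv ℝ S u _)]
  have hΓc : dirD (conjVec (Z u)) (fun u' => chernSymbol d.h (d.F u') (d.push u (Z u)) (S u)) u
      = dAnti (d.push u (Z u)) (fun z => chernSymbol d.h z (d.push u (Z u)) (S u)) (d.F u) := by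
    rw [dirD_comp (f := fun z => chernSymbol d.h z (d.push u (Z u)) (S u))
      (((hd.metric.contDiffAt_chernSymbol hz _ _)).differentiableAt (by simp))
      (hd.differentiableAt hu), conjVec_conjVec]
    change dHol (d.push u (conjVec (Z u))) _ _ + _ = _
    rw [hP u hu, dHol_zero, zero_add]
    rfl
  have hneg : ∀ v w, chernSymbol d.h (d.F u) (-v) w = - chernSymbol d.h (d.F u) v w := by
    intro v w
    simpa using hd.metric.chernSymbol_smul_left hz (-1) v w
  have e₂ : d.covD (conjVec (Z u)) (fun u => d.covD (Z u) S u) u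
      = dirD (conjVec (Z u)) (fun u => dirD (Z u) S u) u
        + dirD (conjVec (Z u)) (fun u => chernSymbol d.h (d.F u) (d.push u (Z u)) (S u)) u := by
    rw [covD, hP u hu, hΓ u hu, add_zero]
    exact dirD_add (hdi (contDiffAt_dirD hZs (hS u hu)))
      (hdi (contDiffAt_bilinear (hd.eventually_chernSymbol_bilinear hu)
        (hd.contDiffAt_chernSymbol hu) hpush (hS u hu))) _
  rw [covD_congr e₁, e₂, hΓd, hΓc, chernCurv, covD, covD, hbr, hPb, hneg]
  abel

/-! ### The Tanaka-Webster connection -/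

theorem isField_extend (z : VC n) : d.IsField U (d.extend z) where
  smooth _ hu := hd.contDiffAt_proj10 hu contDiffAt_const
  isT10 _ hu := hd.isT10_proj10 hu z

theorem extend_self {u : VV n} (hu : u ∈ U) {z : VC n} (hz : d.IsT10 u z) :
    d.extend z u = z := hd.proj10_of_isT10 hu hz

theorem ext_of_h {u : VV n} (hu : u ∈ U) {a b : EE n}
    (h₁ : ∀ v, d.IsT10 u v → d.h (d.F u) a (d.push u v) = d.h (d.F u) b (d.push u v))
    (h₂ : d.h (d.F u) a (d.normal u) = d.h (d.F u) b (d.normal u)) : a = b := by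
  obtain ⟨v, hv, hva⟩ := hd.exists_isT10_push_eq hu (w := a - b)
    (by rw [hd.metric.sub_left, h₂, sub_self])
  rw [← sub_eq_zero, ← hd.metric.self_eq_zero (hd.maps u hu), hd.metric.sub_left, ← hva, h₁ v hv,
    sub_self]

theorem h_normal_sub {u : VV n} (hu : u ∈ U) (a : EE n) :
    d.h (d.F u) (a - (d.h (d.F u) a (d.normal u) / d.h (d.F u) (d.normal u) (d.normal u))
      • d.normal u) (d.normal u) = 0 := by
  rw [hd.metric.sub_left, hd.metric.smul_left, div_mul_cancel₀ _ (hd.h_normal_ne_zero hu),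
    sub_self]

/-- In the torsion-free identity the term differentiating the image of Z̄ drops out, that image
being identically 0. -/
theorem covD_conjVec_push {u : VV n} (hu : u ∈ U) {Z V : VV n → VC n} (hZ : d.IsField U Z)
    (hV : DifferentiableAt ℝ V u) :
    d.covD (conjVec (Z u)) (fun u => d.push u (V u)) u
      = d.push u (bracket (fun u => conjVec (Z u)) V u) := by
  have h0 : (fun u => d.push u (conjVec (Z u))) =ᶠ[𝓝 u] fun _ => 0 :=
    (hd.mem_nhds hu).mono fun u' hu' => (hd.isT10_iff hu').mp (hZ.isT10 u' hu')
  rw [← hd.covD_push_sub hu ((contDiffAt_conjVec (hZ.smooth u hu)).differentiableAt (by simp)) hV,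
    covD_congr h0 (V u)]
  have hz := hd.maps u hu
  simp [covD, hd.metric.chernSymbol_symm hz _ 0, hd.metric.chernSymbol_zero_left hz]

theorem nabla10_spec {u : VV n} (hu : u ∈ U) {Z W : VV n → VC n} (hZ : d.IsField U Z)
    (hW : d.IsField U W) :
    d.IsT10 u (d.nabla10 Z W u) ∧ ∀ v, d.IsT10 u v →
      d.h (d.F u) (d.push u (d.nabla10 Z W u)) (d.push u v)
        = d.h (d.F u) (d.covD (Z u) (fun u => d.push u (W u)) u) (d.push u v) := by
  have hPW := hd.contDiffAt_push hu (hW.smooth u hu)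
  -- Metric compatibility of D turns the defining equation of `nabla10` into orthogonality of D_Z W
  -- - Y to V: D_Z̄ V is the image of [Z̄, V], and the projection of this bracket discards only a
  -- normal part, orthogonal to W.
  have key : ∀ Y : VC n, ∀ V : VV n → VC n, d.IsSection V u →
      (dirD (Z u) (fun u' => d.levi u' (W u') (V u')) u
        = d.levi u Y (V u)
          + d.levi u (W u) (d.proj10 u (bracket (fun u' => conjVec (Z u')) V u)) ↔
      d.h (d.F u) (d.push u Y) (d.push u (V u))
        = d.h (d.F u) (d.covD (Z u) (fun u => d.push u (W u)) u) (d.push u (V u))) := by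
    intro Y V hV
    have hVs := hV.self_of_nhds.1
    have e : (fun u' => d.levi u' (W u') (V u'))
        =ᶠ[𝓝 u] fun u' => d.h (d.F u') (d.push u' (W u')) (d.push u' (V u')) := by
      filter_upwards [hV, hd.mem_nhds hu] with u' hV' hu'
      exact hd.levi_eq hu' _ hV'.2
    rw [dirD_congr e, hd.dirD_h hu (hPW.differentiableAt (by simp))
      ((hd.contDiffAt_push hu hVs).differentiableAt (by simp)),
      hd.covD_conjVec_push hu hZ (hVs.differentiableAt (by simp)),
      hd.levi_eq hu _ hV.self_of_nhds.2, hd.levi_eq hu _ (hd.isT10_proj10 hu _),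
      hd.push_proj10 hu, hd.metric.sub_right, hd.metric.smul_right,
      hd.h_push_normal hu (hW.isT10 u hu), mul_zero, sub_zero, add_left_inj, eq_comm]
  have hex : ∃ Y, d.IsT10 u Y ∧ ∀ V : VV n → VC n, d.IsSection V u →
      dirD (Z u) (fun u' => d.levi u' (W u') (V u')) u
        = d.levi u Y (V u)
          + d.levi u (W u) (d.proj10 u (bracket (fun u' => conjVec (Z u')) V u)) := by
    obtain ⟨Y, hY, hYe⟩ := hd.exists_isT10_push_eq hu
      (hd.h_normal_sub hu (d.covD (Z u) (fun u => d.push u (W u)) u))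
    refine ⟨Y, hY, fun V hV => (key Y V hV).mpr ?_⟩
    rw [hYe, hd.metric.sub_left, hd.metric.smul_left, hd.h_normal_push hu hV.self_of_nhds.2,
      mul_zero, sub_zero]
  have hspec := Classical.epsilon_spec hex
  refine ⟨hspec.1, fun v hv => ?_⟩
  have hsec : d.IsSection (d.extend v) u := (hd.mem_nhds hu).mono fun u' hu' =>
    ⟨(hd.isField_extend v).smooth u' hu', (hd.isField_extend v).isT10 u' hu'⟩
  have := (key _ _ hsec).mp (hspec.2 _ hsec)
  rw [hd.extend_self hu hv] at this
  exact this

/-- Up to normal components, `∇_Y W` is `∇̃_Y W - θ(Y) ∇̃_W N`. -/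
theorem nabla_spec {u : VV n} (hu : u ∈ U) {Y W : VV n → VC n}
    (hY : ∀ u ∈ U, ContDiffAt ℝ ∞ Y u) (hW : d.IsField U W) :
    d.IsT10 u (d.nabla Y W u) ∧ ∀ v, d.IsT10 u v →
      d.h (d.F u) (d.push u (d.nabla Y W u)) (d.push u v)
        = d.h (d.F u) (d.covD (Y u) (fun u => d.push u (W u)) u
          - d.thetaC u (Y u) • d.covD (W u) d.normal u) (d.push u v) := by
  have hA : d.IsField U fun u => d.proj10 u (Y u) :=
    ⟨fun u hu => hd.contDiffAt_proj10 hu (hY u hu), fun u hu => hd.isT10_proj10 hu _⟩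
  obtain ⟨h1, h2⟩ := hd.nabla10_spec hu hA hW
  refine ⟨hd.isT10_add hu h1 (hd.isT10_proj10 hu _), fun v hv => ?_⟩
  have hBs : ContDiffAt ℝ ∞ (fun u => Y u - d.proj10 u (Y u)) u := (hY u hu).sub (hA.smooth u hu)
  -- The part B of Y outside T^{1,0}M pushes to θ(Y) N. Torsion-freeness gives [B, W] the image D_B
  -- W - θ(Y) D_W N - W(θ(Y)) N, whose last term is normal.
  have hPB : (fun u => d.push u (Y u - d.proj10 u (Y u)))
      =ᶠ[𝓝 u] fun u => d.thetaC u (Y u) • d.normal u := by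
    filter_upwards [hd.mem_nhds hu] with u' hu'
    rw [push_sub, hd.push_proj10 hu', sub_sub_cancel]
  have h3 := hd.covD_push_sub hu (hBs.differentiableAt (by simp))
    ((hW.smooth u hu).differentiableAt (by simp))
  rw [covD_congr hPB, hd.covD_smul hu
    ((hd.contDiffAt_thetaC hu (hY u hu)).differentiableAt (by simp))
    ((hd.contDiffAt_normal hu).differentiableAt (by simp))] at h3
  have h4 : d.covD (Y u) (fun u => d.push u (W u)) u
      = d.covD (d.proj10 u (Y u)) (fun u => d.push u (W u)) u
        + d.covD (Y u - d.proj10 u (Y u)) (fun u => d.push u (W u)) u := by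
    rw [← covD_add_left hd hu, add_sub_cancel]
  have hN := hd.h_normal_push hu hv
  rw [nabla, push_add, hd.push_proj10 hu, ← h3, h4]
  simp only [hd.metric.add_left, hd.metric.sub_left, hd.metric.smul_left, h2 v hv, hN]
  ring

theorem push_nabla {u : VV n} (hu : u ∈ U) {Y W : VV n → VC n}
    (hY : ∀ u ∈ U, ContDiffAt ℝ ∞ Y u) (hW : d.IsField U W) {A : EE n}
    (hA : A = d.covD (Y u) (fun u => d.push u (W u)) u
          - d.thetaC u (Y u) • d.covD (W u) d.normal u) :
    d.push u (d.nabla Y W u)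
      = A - (d.h (d.F u) A (d.normal u) / d.h (d.F u) (d.normal u) (d.normal u))
        • d.normal u := by
  obtain ⟨h1, h2⟩ := hd.nabla_spec hu hY hW
  refine hd.ext_of_h hu (fun v hv => ?_) ?_
  · rw [h2 v hv, ← hA, hd.metric.sub_left, hd.metric.smul_left, hd.h_normal_push hu hv, mul_zero,
      sub_zero]
  · rw [hd.h_push_normal hu h1, hd.h_normal_sub hu]

/-- Needed to iterate ∇ in the curvature: the explicit formula of `push_nabla` shows that ∇_Y W is
again smooth. -/
theorem isField_nabla {Y W : VV n → VC n} (hY : ∀ u ∈ U, ContDiffAt ℝ ∞ Y u)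
    (hW : d.IsField U W) : d.IsField U (d.nabla Y W) where
  isT10 u hu := (hd.nabla_spec hu hY hW).1
  smooth u hu := by
    refine hd.contDiffAt_of_push hu ?_
      ((hd.mem_nhds hu).mono fun u' hu' => (hd.nabla_spec hu' hY hW).1)
    refine ContDiffAt.congr_of_eventuallyEq ?_
      ((hd.mem_nhds hu).mono fun u' hu' => hd.push_nabla hu' hY hW rfl)
    have hN := hd.contDiffAt_normal hu
    have hA : ContDiffAt ℝ ∞ (fun u => d.covD (Y u) (fun u => d.push u (W u)) u
          - d.thetaC u (Y u) • d.covD (W u) d.normal u) u :=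
      (hd.contDiffAt_covD hu (hY u hu) (hd.contDiffAt_push hu (hW.smooth u hu))).sub
        ((hd.contDiffAt_thetaC hu (hY u hu)).smul (hd.contDiffAt_covD hu (hW.smooth u hu) hN))
    simp only [div_eq_mul_inv]
    exact hA.sub (((hd.contDiffAt_h hu hA hN).mul ((hd.contDiffAt_h hu hN hN).inv
      (hd.h_normal_ne_zero hu))).smul hN)

/-! ### The second fundamental form and the torsion -/

/-- The Y-derivative of ⟨W, N̄⟩ = 0. -/
theorem h_covD_normal {u : VV n} (hu : u ∈ U) {W : VV n → VC n} (hW : d.IsField U W) (Y : VC n) :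
    d.h (d.F u) (d.covD Y (fun u => d.push u (W u)) u) (d.normal u)
      = - d.h (d.F u) (d.push u (W u)) (d.covD (conjVec Y) d.normal u) := by
  have h := hd.dirD_h hu ((hd.contDiffAt_push hu (hW.smooth u hu)).differentiableAt (by simp))
    ((hd.contDiffAt_normal hu).differentiableAt (by simp)) Y
  have h0 : (fun u => d.h (d.F u) (d.push u (W u)) (d.normal u)) =ᶠ[𝓝 u] fun _ => 0 :=
    (hd.mem_nhds hu).mono fun u' hu' => hd.h_push_normal hu' (hW.isT10 u' hu')
  rw [dirD_congr h0, dirD_const] at h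
  exact eq_neg_of_add_eq_zero_left h.symm

theorem thetaC_bracket_conjVec {u : VV n} (hu : u ∈ U) {Z W : VV n → VC n} (hZ : d.IsField U Z)
    (hW : d.IsField U W) :
    d.thetaC u (bracket (fun u => conjVec (Z u)) W u)
      = Complex.I * d.h (d.F u) (d.push u (W u)) (d.push u (Z u)) := by
  have h0 : (fun u => d.thetaC u (W u)) =ᶠ[𝓝 u] fun _ => 0 :=
    (hd.mem_nhds hu).mono fun u' hu' => hd.thetaC_isT10 hu' (hW.isT10 u' hu')
  have h1 : (fun u => d.thetaC u (conjVec (Z u))) =ᶠ[𝓝 u] fun _ => 0 :=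
    (hd.mem_nhds hu).mono fun u' hu' => by
      beta_reduce
      rw [thetaC_conjVec, hd.thetaC_isT10 hu' (hZ.isT10 u' hu'), map_zero]
  rw [hd.thetaC_bracket hu ((contDiffAt_conjVec (hZ.smooth u hu)).differentiableAt (by simp))
    ((hW.smooth u hu).differentiableAt (by simp)), dirD_congr h0, dirD_congr h1, dirD_const,
    dirD_const, hd.dThetaC_eq hu, conjVec_conjVec, (hd.isT10_iff hu).mp (hZ.isT10 u hu),
    hd.metric.zero_left]
  ring

/-- D_Z̄ W is the image of [Z̄, W], whose N-coefficient θ([Z̄, W]) = -dθ(Z̄, W) is given by the Levi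
form. -/
theorem h_covD_conjVec_normal {u : VV n} (hu : u ∈ U) {Z W : VV n → VC n} (hZ : d.IsField U Z)
    (hW : d.IsField U W) :
    d.h (d.F u) (d.covD (conjVec (Z u)) (fun u => d.push u (W u)) u) (d.normal u)
      = Complex.I * d.h (d.F u) (d.push u (W u)) (d.push u (Z u))
        * d.h (d.F u) (d.normal u) (d.normal u) := by
  rw [hd.covD_conjVec_push hu hZ ((hW.smooth u hu).differentiableAt (by simp)),
    hd.h_push_normal_eq hu, hd.thetaC_bracket_conjVec hu hZ hW]

/-- For Y in the contact distribution ∇_Y W is the projection of D_Y W, so only the N-component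
survives in the difference. -/
theorem secondFF_eq {u : VV n} (hu : u ∈ U) {Y W : VV n → VC n}
    (hY : ∀ u ∈ U, ContDiffAt ℝ ∞ Y u) (hW : d.IsField U W) (hθ : d.thetaC u (Y u) = 0) :
    d.secondFF Y W u
      = (d.h (d.F u) (d.covD (Y u) (fun u => d.push u (W u)) u) (d.normal u)
          / d.h (d.F u) (d.normal u) (d.normal u)) • d.normal u := by
  rw [secondFF, hd.push_nabla hu hY hW rfl, hθ, zero_smul, sub_zero, ← sub_add]
  change d.covD (Y u) (fun u => d.push u (W u)) u - d.covD (Y u) (fun u => d.push u (W u)) u + _ = _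
  rw [sub_self, zero_add]

theorem contDiffAt_extendBar {u : VV n} (hu : u ∈ U) (z : VC n) :
    ContDiffAt ℝ ∞ (d.extendBar z) u :=
  contDiffAt_conjVec ((hd.isField_extend z).smooth u hu)

theorem secondFFBarAt_eq {u : VV n} (hu : u ∈ U) {z w : VC n} (hz : d.IsT10 u z)
    (hw : d.IsT10 u w) : d.secondFFBarAt u z w = (Complex.I * d.levi u w z) • d.normal u := by
  have hZ := hd.isField_extend z
  have hW := hd.isField_extend w
  have hθ : d.thetaC u (d.extendBar z u) = 0 := by
    rw [extendBar, thetaC_conjVec, hd.thetaC_isT10 hu (hd.isT10_proj10 hu z), map_zero]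
  rw [secondFFBarAt, hd.secondFF_eq hu (fun u hu => hd.contDiffAt_extendBar hu z) hW hθ]
  have h := hd.h_covD_conjVec_normal hu hZ hW
  rw [hd.extend_self hu hz, hd.extend_self hu hw] at h
  have hb : d.extendBar z u = conjVec z := congrArg conjVec (hd.extend_self hu hz)
  rw [hb, h, mul_div_cancel_right₀ _ (hd.h_normal_ne_zero hu), hd.levi_eq hu _ hz]

/-- θ([T, Z]) = 0 makes the image of [T, Z] orthogonal to N, so ∇_T Z and [T, Z] have the same
(1,0)-image and τZ is of type (0,1). After conjugation ∇_T Z contributes nothing, and [Z̄, T] has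
image D_Z̄ N. -/
theorem conjVec_tauAt {u : VV n} (hu : u ∈ U) {z : VC n} (hz : d.IsT10 u z) :
    d.IsT10 u (conjVec (d.tauAt u z)) ∧
      d.push u (conjVec (d.tauAt u z)) = d.covD (conjVec z) d.normal u := by
  have hZ := hd.isField_extend z
  have hTs := fun u (hu : u ∈ U) => hd.contDiffAt_reebC hu
  have hTd := (hTs u hu).differentiableAt (by simp)
  have hZd := (hZ.smooth u hu).differentiableAt (by simp)
  have hb := hd.covD_push_sub hu hTd hZd
  have hθ : d.thetaC u (bracket d.reebC (d.extend z) u) = 0 := by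
    have h0 : (fun u => d.thetaC u (d.extend z u)) =ᶠ[𝓝 u] fun _ => 0 :=
      (hd.mem_nhds hu).mono fun u' hu' => hd.thetaC_isT10 hu' (hZ.isT10 u' hu')
    have h1 : (fun u => d.thetaC u (d.reebC u)) =ᶠ[𝓝 u] fun _ => 1 :=
      (hd.mem_nhds hu).mono fun u' hu' => hd.thetaC_reebC hu'
    have h2 : conjVec (d.reebC u) = d.reebC u := conjVec_ofRealVec _
    have h3 := hd.h_push_normal hu (hZ.isT10 u hu)
    rw [normal] at h3
    rw [hd.thetaC_bracket hu hTd hZd, dirD_congr h0, dirD_congr h1, dirD_const, dirD_const,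
      hd.dThetaC_eq hu, (hd.isT10_iff hu).mp (hZ.isT10 u hu), hd.metric.zero_right, h2, h3]
    ring
  have hPn : d.push u (d.nabla d.reebC (d.extend z) u)
      = d.push u (bracket d.reebC (d.extend z) u) := by
    have hA : d.push u (bracket d.reebC (d.extend z) u)
        = d.covD (d.reebC u) (fun u => d.push u (d.extend z u)) u
          - d.thetaC u (d.reebC u) • d.covD (d.extend z u) d.normal u := by
      rw [hd.thetaC_reebC hu, one_smul, ← hb]
      rfl
    rw [hd.push_nabla hu hTs hZ hA, hd.h_push_normal_eq hu, hθ, zero_mul, zero_div, zero_smul,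
      sub_zero]
  constructor
  · rw [hd.isT10_iff hu, conjVec_conjVec, tauAt, tau, push_sub, hPn, sub_self]
  · rw [tauAt, tau, conjVec_sub, push_sub,
      (hd.isT10_iff hu).mp (hd.nabla_spec hu hTs hZ).1, conjVec_bracket hTd hZd]
    have h2 : (fun u => conjVec (d.reebC u)) = d.reebC := funext fun u => conjVec_ofRealVec _
    rw [h2]
    have h3 := hd.covD_conjVec_push hu hZ hTd
    rw [hd.extend_self hu hz] at h3
    change _ = d.covD (conjVec z) (fun u => d.push u (d.reebC u)) u
    rw [h3, bracket, bracket, push_sub, push_sub, zero_sub, neg_sub]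

end IsGood
end LocalData
end SemiIsometric

/-! ### Torsion and umbilicity, mean curvature, and the Gauss equation -/

namespace SemiIsometric
namespace LocalData
namespace IsGood

variable {n : ℕ} {d : LocalData n} {U : Set (VV n)} {Ω : Set (EE n)} (hd : d.IsGood U Ω)
include hd

theorem h_covD_extend_normal {u : VV n} (hu : u ∈ U) {z w : VC n} (hz : d.IsT10 u z)
    (hw : d.IsT10 u w) :
    d.h (d.F u) (d.covD z (fun u => d.push u (d.extend w u)) u) (d.normal u)
      = - d.levi u w (conjVec (d.tauAt u z)) := by
  obtain ⟨h1, h2⟩ := hd.conjVec_tauAt hu hz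
  rw [hd.h_covD_normal hu (hd.isField_extend w), hd.levi_eq hu _ h1, h2, hd.extend_self hu hw]

theorem secondFFAt_eq {u : VV n} (hu : u ∈ U) {z w : VC n} (hz : d.IsT10 u z)
    (hw : d.IsT10 u w) :
    d.secondFFAt u z w = (- d.levi u w (conjVec (d.tauAt u z))
      / d.h (d.F u) (d.normal u) (d.normal u)) • d.normal u := by
  have hZ := hd.isField_extend z
  rw [secondFFAt, hd.secondFF_eq hu hZ.smooth (hd.isField_extend w)
    (hd.thetaC_isT10 hu (hZ.isT10 u hu)), hd.extend_self hu hz, hd.h_covD_extend_normal hu hz hw]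

theorem tauAt_eq_zero_iff {u : VV n} (hu : u ∈ U) :
    (∀ z, d.IsT10 u z → d.tauAt u z = 0) ↔
      ∀ z w, d.IsT10 u z → d.IsT10 u w → d.secondFFAt u z w = 0 := by
  constructor
  · intro h z w hz hw
    have h0 := (hd.isT10_zero hu)
    rw [hd.secondFFAt_eq hu hz hw, h z hz, conjVec_zero, hd.levi_eq hu _ h0, push_zero,
      hd.metric.zero_right, neg_zero, zero_div, zero_smul]
  · intro h z hz
    obtain ⟨h1, -⟩ := hd.conjVec_tauAt hu hz
    -- II(z, ·) is tested on the conjugate of τz, where it is a multiple of the squared length of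
    -- that vector.
    have h2 := h z _ hz h1
    rw [hd.secondFFAt_eq hu hz h1, smul_eq_zero, or_iff_left (hd.normal_ne_zero hu), div_eq_zero_iff,
      or_iff_left (hd.h_normal_ne_zero hu), neg_eq_zero] at h2
    by_contra h3
    exact hd.levi_self_ne_zero hu h1 (by simpa using h3) h2

/-! ### The mean curvature -/

theorem exists_unitary {u : VV n} (hu : u ∈ U) (k : ℕ) (hk : k ≤ n) :
    ∃ e : Fin k → VC n, (∀ α, d.IsT10 u (e α)) ∧
      ∀ α β, d.levi u (e α) (e β) = if α = β then 1 else 0 := by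
  induction k with
  | zero => exact ⟨Fin.elim0, fun α => α.elim0, fun α => α.elim0⟩
  | succ k ih =>
    obtain ⟨e, he, hee⟩ := ih (by omega)
    let Φ : VC n →ₗ[ℂ] EE n × (Fin k → ℂ) :=
      { toFun := fun Z => (dirD Z (fun u' => conjVec (d.F u')) u,
          fun α => d.h (d.F u) (d.push u Z) (d.push u (e α)))
        map_add' := fun Z W => by
          ext1
          · exact dirD_add_left _ _ _ _
          · ext α
            simp [push_add, hd.metric.add_left]
        map_smul' := fun c Z => by
          ext1
          · exact dirD_smul_left _ _ _ _
          · ext α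
            simp [push_smul, hd.metric.smul_left] }
    -- Type (1,0) and orthogonality to the k previous vectors impose n + 1 + k ≤ 2n conditions on 2n
    -- + 1 unknowns. The dimension of T^{1,0}M is thus never needed.
    have hker : LinearMap.ker Φ ≠ ⊥ := by
      apply LinearMap.ker_ne_bot_of_finrank_lt
      simp
      omega
    obtain ⟨z, hz, hz0⟩ := (Submodule.ne_bot_iff _).mp hker
    have hzT : d.IsT10 u z := congrArg Prod.fst (LinearMap.mem_ker.mp hz)
    have hze : ∀ α, d.h (d.F u) (d.push u z) (d.push u (e α)) = 0 := fun α =>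
      congrFun (congrArg Prod.snd (LinearMap.mem_ker.mp hz)) α
    have hP : d.push u z ≠ 0 := fun h =>
      hz0 (hd.eq_zero_of_push hu h ((hd.isT10_iff hu).mp hzT))
    have hpos := hd.metric.pos _ (hd.maps u hu) _ hP
    set r := (d.h (d.F u) (d.push u z) (d.push u z)).re with hr
    have hsq : ((Real.sqrt r : ℝ) : ℂ) ^ 2 = d.h (d.F u) (d.push u z) (d.push u z) := by
      rw [← hd.metric.ofReal_re_self, ← hr, ← Complex.ofReal_pow, Real.sq_sqrt hpos.le]
    have hs0 : ((Real.sqrt r : ℝ) : ℂ) ≠ 0 :=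
      Complex.ofReal_ne_zero.mpr (Real.sqrt_pos.mpr hpos).ne'
    set z' := ((Real.sqrt r : ℝ) : ℂ)⁻¹ • z with hz'
    have hz'T : d.IsT10 u z' := hd.isT10_smul hu _ hzT
    have h1 : ∀ α, d.h (d.F u) (d.push u z') (d.push u (e α)) = 0 := fun α => by
      rw [hz', push_smul, hd.metric.smul_left, hze, mul_zero]
    refine ⟨Fin.cons z' e, fun α => ?_, fun α β => ?_⟩
    · refine Fin.cases ?_ (fun α => ?_) α
      · exact hz'T
      · exact he α
    · refine Fin.cases ?_ (fun α => ?_) α <;> refine Fin.cases ?_ (fun β => ?_) β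
      · rw [Fin.cons_zero, hd.levi_eq hu _ hz'T, hz', push_smul, hd.metric.smul_left,
          hd.metric.smul_right, ← hsq, map_inv₀, Complex.conj_ofReal, if_pos rfl]
        field_simp
      · rw [Fin.cons_zero, Fin.cons_succ, hd.levi_eq hu _ (he β), h1,
          if_neg (Fin.succ_ne_zero β).symm]
      · rw [Fin.cons_zero, Fin.cons_succ, hd.levi_eq hu _ hz'T, hd.metric.conj_symm, h1, map_zero,
          if_neg (Fin.succ_ne_zero α)]
      · rw [Fin.cons_succ, Fin.cons_succ, hee]
        simp [Fin.succ_inj]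

/-- Every summand II(Z_ᾱ, Z_α) equals iN for a unit vector, so neither the chosen basis nor any
trace computation matters. -/
theorem meanCurv_eq {u : VV n} (hu : u ∈ U) (hn : n ≠ 0) :
    d.meanCurv u = Complex.I • d.normal u := by
  obtain ⟨h1, h2⟩ : d.IsUnitaryBasis u (d.unitaryBasis u) :=
    Classical.epsilon_spec (p := d.IsUnitaryBasis u) (hd.exists_unitary hu n le_rfl)
  have : ∀ α, d.secondFFBarAt u (d.unitaryBasis u α) (d.unitaryBasis u α)
      = Complex.I • d.normal u := fun α => by
    rw [hd.secondFFBarAt_eq hu (h1 α) (h1 α), h2, if_pos rfl, mul_one]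
  rw [meanCurv, Finset.sum_congr rfl fun α _ => this α, Finset.sum_const, Finset.card_univ,
    Fintype.card_fin, ← Nat.cast_smul_eq_nsmul ℂ, smul_smul,
    one_div_mul_cancel (Nat.cast_ne_zero.mpr hn), one_smul]

theorem ofReal_meanCurvSq {u : VV n} (hu : u ∈ U) (hn : n ≠ 0) :
    (d.meanCurvSq u : ℂ) = d.h (d.F u) (d.normal u) (d.normal u) := by
  rw [meanCurvSq, hd.metric.ofReal_re_self, hd.meanCurv_eq hu hn, hd.metric.smul_left,
    hd.metric.smul_right, Complex.conj_I]
  linear_combination (-d.h (d.F u) (d.normal u) (d.normal u)) * Complex.I_mul_I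

theorem meanCurvSq_pos {u : VV n} (hu : u ∈ U) (hn : n ≠ 0) : 0 < d.meanCurvSq u := by
  have h := congrArg Complex.re (hd.ofReal_meanCurvSq hu hn)
  rw [Complex.ofReal_re] at h
  rw [h]
  exact hd.metric.pos _ (hd.maps u hu) _ (hd.normal_ne_zero hu)

/-- For n = 0 there is a single coordinate, and θ(T) = 1 makes θ injective, whereas θ(z) = 0. This
legitimizes the factor 1/n in H. -/
theorem dim_ne_zero {u : VV n} (hu : u ∈ U) {z : VC n} (hz : d.IsT10 u z) (h0 : z ≠ 0) :
    n ≠ 0 := by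
  rintro rfl
  have : Subsingleton (Fin (2 * 0 + 1)) := inferInstanceAs (Subsingleton (Fin 1))
  have h1 := hd.thetaC_isT10 hu hz
  have h2 := hd.thetaC_reebC hu
  rw [thetaC, Fintype.sum_subsingleton _ (0 : Fin (2 * 0 + 1))] at h1 h2
  refine h0 ?_
  ext a
  rw [Subsingleton.elim a 0]
  exact (mul_eq_zero.mp h1).resolve_right (right_ne_zero_of_mul (h2.trans_ne one_ne_zero))

/-! ### The Gauss equation -/

/-- Write ∇_Z̄ Z = D_Z̄ Z - lN and ∇_Z Z = D_Z Z - sN with l = i|Z|² and s = -⟨τZ, Z⟩/|N|². Pairing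
with Z kills derivatives of l and s. The term l⟨D_Z N, Z̄⟩ occurs twice, from differentiating lN and
from θ([Z, Z̄]) = -l in ∇_{[Z,Z̄]}, whence the factor 2; the term s⟨D_Z̄ N, Z̄⟩ gives the torsion.
-/
theorem levi_curv {u : VV n} (hu : u ∈ U) {z : VC n} (hz : d.IsT10 u z) :
    d.levi u (d.curv (d.extend z) (d.extendBar z) (d.extend z) u) z
      = d.h (d.F u) (chernCurv d.h (d.F u) (d.push u z) (d.push u z) (d.push u z)) (d.push u z)
        + 2 * d.levi u z z ^ 2 * d.h (d.F u) (d.normal u) (d.normal u)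
        - d.levi u z (conjVec (d.tauAt u z))
          * starRingEnd ℂ (d.levi u z (conjVec (d.tauAt u z)))
          / d.h (d.F u) (d.normal u) (d.normal u) := by
  have hm := hd.metric
  have hZ := hd.isField_extend z
  have hZb := fun u (hu : u ∈ U) => hd.contDiffAt_extendBar hu z
  have hzu := hd.extend_self hu hz
  have hzbu : d.extendBar z u = conjVec z := congrArg conjVec hzu
  have hdi : ∀ {G : Type} [NormedAddCommGroup G] [NormedSpace ℝ G] {f : VV n → G},
      ContDiffAt ℝ ∞ f u → DifferentiableAt ℝ f u := fun h => h.differentiableAt (by simp)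
  set P : VV n → EE n := fun u => d.push u (d.extend z u) with hPdef
  have hPs : ∀ u ∈ U, ContDiffAt ℝ ∞ P u := fun u hu => hd.contDiffAt_push hu (hZ.smooth u hu)
  have hPu : P u = d.push u z := congrArg (d.push u) hzu
  have hN0 := hd.h_normal_ne_zero hu
  have hN := hd.contDiffAt_normal hu
  have hNP := hd.h_normal_push hu hz
  set ν : VV n → ℂ := fun u => d.h (d.F u) (d.normal u) (d.normal u) with hν
  set l : VV n → ℂ := fun u => Complex.I * d.h (d.F u) (P u) (P u) with hl
  set s : VV n → ℂ := fun u => d.h (d.F u) (d.covD (d.extend z u) P u) (d.normal u) / ν u with hs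
  have hls : ContDiffAt ℝ ∞ l u := contDiffAt_const.mul (hd.contDiffAt_h hu (hPs u hu) (hPs u hu))
  have hss : ContDiffAt ℝ ∞ s u := by
    simp only [hs, div_eq_mul_inv]
    exact (hd.contDiffAt_h hu (hd.contDiffAt_covD hu (hZ.smooth u hu) (hPs u hu)) hN).mul
      ((hd.contDiffAt_h hu hN hN).inv hN0)
  have hθb : ∀ u ∈ U, d.thetaC u (d.extendBar z u) = 0 := fun u hu => by
    rw [extendBar, thetaC_conjVec, hd.thetaC_isT10 hu (hd.isT10_proj10 hu z), map_zero]
  have e₁ : (fun u => d.push u (d.nabla (d.extendBar z) (d.extend z) u))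
      =ᶠ[𝓝 u] fun u => d.covD (d.extendBar z u) P u - l u • d.normal u := by
    filter_upwards [hd.mem_nhds hu] with v hv
    rw [hd.push_nabla hv hZb hZ rfl, hθb v hv, zero_smul, sub_zero]
    have := hd.h_covD_conjVec_normal hv hZ hZ
    change d.h (d.F v) (d.covD (d.extendBar z v) P v) (d.normal v) = l v * ν v at this
    rw [this, mul_div_cancel_right₀ _ (hd.h_normal_ne_zero hv)]
  have e₂ : (fun u => d.push u (d.nabla (d.extend z) (d.extend z) u))
      =ᶠ[𝓝 u] fun u => d.covD (d.extend z u) P u - s u • d.normal u := by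
    filter_upwards [hd.mem_nhds hu] with v hv
    rw [hd.push_nabla hv hZ.smooth hZ rfl, hd.thetaC_isT10 hv (hZ.isT10 v hv), zero_smul,
      sub_zero]
  have k₁ := (hd.nabla_spec hu hZ.smooth (hd.isField_nabla hZb hZ)).2 z hz
  have k₂ := (hd.nabla_spec hu hZb (hd.isField_nabla hZ.smooth hZ)).2 z hz
  have hbrs : ∀ u ∈ U, ContDiffAt ℝ ∞ (bracket (d.extend z) (d.extendBar z)) u := fun u hu =>
    contDiffAt_bracket (hZ.smooth u hu) (hZb u hu)
  have k₃ := (hd.nabla_spec hu hbrs hZ).2 z hz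
  have hbθ : d.thetaC u (bracket (d.extend z) (d.extendBar z) u) = - l u := by
    have := hd.thetaC_bracket_conjVec hu hZ hZ
    have hneg : bracket (d.extend z) (d.extendBar z) u
        = (-1 : ℂ) • bracket (fun u => conjVec (d.extend z u)) (d.extend z) u := by
      rw [neg_one_smul, bracket, bracket, neg_sub]
      rfl
    rw [hneg, thetaC_smul, this]
    simp [hl, hPdef]
  rw [covD_congr e₁, hd.covD_sub hu (hdi (hd.contDiffAt_covD hu (hZb u hu) (hPs u hu)))
    ((hdi hls).fun_smul (hdi hN)), hd.covD_smul hu (hdi hls) (hdi hN),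
    hd.thetaC_isT10 hu (hZ.isT10 u hu), zero_smul, sub_zero] at k₁
  rw [covD_congr e₂, hd.covD_sub hu (hdi (hd.contDiffAt_covD hu (hZ.smooth u hu) (hPs u hu)))
    ((hdi hss).fun_smul (hdi hN)), hd.covD_smul hu (hdi hss) (hdi hN), hθb u hu, zero_smul, sub_zero] at k₂
  rw [hbθ] at k₃
  have hR := congrArg (fun w => d.h (d.F u) w (d.push u z)) (hd.covD_curvature hu hZ hPs)
  -- The tangential part of DN is minus the adjoint of the N-component of D on tangent fields, so
  -- both remaining terms reduce to quantities already computed.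
  have hcompat : ∀ Y : VC n, d.h (d.F u) (d.covD Y d.normal u) (d.push u z)
      = - starRingEnd ℂ (d.h (d.F u) (d.covD (conjVec Y) P u) (d.normal u)) := by
    intro Y
    rw [hd.h_covD_normal hu hZ, conjVec_conjVec, hzu, map_neg, neg_neg, ← hm.conj_symm]
  have c₁ := hcompat z
  have c₂ := hcompat (conjVec z)
  rw [conjVec_conjVec, hd.h_covD_extend_normal hu hz hz] at c₂
  have hb := hd.h_covD_conjVec_normal hu hZ hZ
  rw [hzu] at hb
  rw [hb] at c₁
  have hsu : s u = - d.levi u z (conjVec (d.tauAt u z)) / ν u := by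
    simp only [hs]
    rw [hzu, hd.h_covD_extend_normal hu hz hz]
  have hreal : ∀ v, starRingEnd ℂ (d.h (d.F u) v v) = d.h (d.F u) v v := fun v =>
    (hm.conj_symm _ v v).symm
  have hlu : l u = Complex.I * d.levi u z z := by
    rw [hd.levi_eq hu z hz]
    simp only [hl, hPu]
  have hLr : starRingEnd ℂ (d.levi u z z) = d.levi u z z := by
    rw [hd.levi_eq hu z hz, hreal]
  rw [← hd.levi_eq hu z hz, map_mul, map_mul, hreal, hLr, Complex.conj_I] at c₁
  rw [hd.levi_eq hu _ hz, curv, push_sub, push_sub]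
  simp only [hm.sub_left, hm.add_left, hm.smul_left, hzu, hzbu, hNP, hPu, hsu, hlu] at k₁ k₂ k₃ hR ⊢
  change d.h (d.F u) (d.covD z (fun u => d.covD (d.extendBar z u) P u) u) (d.push u z)
    - _ - d.h (d.F u) (d.covD (bracket (d.extend z) (d.extendBar z) u) P u) (d.push u z) = _ at hR
  rw [k₁, k₂, k₃, ← hR, c₁, c₂, map_neg, neg_neg]
  simp only [hPdef, hν]
  linear_combination (-2 * d.levi u z z ^ 2 * d.h (d.F u) (d.normal u) (d.normal u))
    * Complex.I_mul_I

theorem holSec_add_holTor {u : VV n} (hu : u ∈ U) {z : VC n} (hz : d.IsT10 u z) (h0 : z ≠ 0) :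
    d.holSec u z + ((1 / 2 * (‖d.holTor u z‖ ^ 2 / d.meanCurvSq u) : ℝ) : ℂ)
      = 1 / 2 * d.ambientHolSec u z + (d.meanCurvSq u : ℂ) := by
  have hL0 := hd.levi_self_ne_zero hu hz h0
  have hN0 := hd.h_normal_ne_zero hu
  have hLr : starRingEnd ℂ (d.levi u z z) = d.levi u z z := by
    rw [hd.levi_eq hu z hz, ← hd.metric.conj_symm]
  have htor : ((‖d.holTor u z‖ ^ 2 : ℝ) : ℂ) = d.levi u z (conjVec (d.tauAt u z))
      * starRingEnd ℂ (d.levi u z (conjVec (d.tauAt u z))) / d.levi u z z ^ 2 := by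
    rw [Complex.ofReal_pow, ← Complex.mul_conj', holTor, map_div₀, map_mul, hLr, Complex.conj_I]
    field_simp
    rw [Complex.I_sq]
    ring
  rw [Complex.ofReal_mul, Complex.ofReal_div (‖d.holTor u z‖ ^ 2), htor,
    hd.ofReal_meanCurvSq hu (hd.dim_ne_zero hu hz h0), holSec, hd.levi_curv hu hz, ambientHolSec,
    chernHolSec, ← hd.levi_eq hu z hz]
  push_cast
  field_simp
  ring

end IsGood
end LocalData
end SemiIsometric

/-! ### From manifolds to charts -/

namespace SemiIsometric

section Charts

variable {n : ℕ} {X : Type*} [TopologicalSpace X] [ChartedSpace (EE n) X]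
  [IsManifold 𝓘(ℂ, EE n) ∞ X]
  {M : Type*} [TopologicalSpace M] [ChartedSpace (VV n) M] [IsManifold 𝓘(ℝ, VV n) ∞ M]

/-- The hypersurface map is only real-smooth, so its chart expressions are handled over ℝ;
holomorphic coordinate changes are in particular real-smooth. -/
theorem isManifold_real_of_complex (n : ℕ) (X : Type*) [TopologicalSpace X]
    [ChartedSpace (EE n) X] [IsManifold 𝓘(ℂ, EE n) ∞ X] : IsManifold 𝓘(ℝ, EE n) ∞ X := by
  refine isManifold_of_contDiffOn _ _ _ fun e e' he he' => ?_
  have h : e.symm ≫ₕ e' ∈ contDiffGroupoid ∞ 𝓘(ℂ, EE n) := HasGroupoid.compatible he he'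
  exact ContDiffOn.restrict_scalars ℝ (mem_groupoid_of_pregroupoid.mp h).1

theorem KahlerMetric.isKahlerOn_inChart (g : KahlerMetric n X) (x : X) :
    IsKahlerOn (g.form.inChart x) (extChartAt 𝓘(ℂ, EE n) x).target where
  isOpen := isOpen_extChartAt_target x
  add_left z v v' w :=
    (congrArg (fun y => g.form _ y _) (map_add
      (mfderiv 𝓘(ℂ, EE n) 𝓘(ℂ, EE n) (extChartAt 𝓘(ℂ, EE n) x).symm z) v v')).trans (LinearMap.map_add₂ _ _ _ _)
  smul_left z c v w :=
    (congrArg (fun y => g.form _ y _) (map_smul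
      (mfderiv 𝓘(ℂ, EE n) 𝓘(ℂ, EE n) (extChartAt 𝓘(ℂ, EE n) x).symm z) c v)).trans (LinearMap.map_smul₂ _ _ _ _)
  conj_symm z v w := g.conj_symm _ _ _
  pos z hz v hv := by
    refine g.pos _ _ fun h => hv ?_
    have := IsManifold.of_le (I := 𝓘(ℂ, EE n)) (M := X) (m := 1) (n := ∞) (by simp)
    -- Positivity passes to coordinates because the inverse chart has injective differential on the
    -- chart target.
    have hinv := isInvertible_mfderivWithin_extChartAt_symm (I := 𝓘(ℂ, EE n)) hz
    rw [ModelWithCorners.range_eq_univ, mfderivWithin_univ] at hinv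
    exact hinv.injective (h.trans (map_zero _).symm)
  smooth z hz v w := (g.smooth x v w).contDiffAt ((isOpen_extChartAt_target x).mem_nhds hz)
  closed z hz := g.closed x z hz

theorem IsSemiIsometricHypersurface.exists_isGood {g : KahlerMetric n X} {θ : OneForm n M}
    {ι : M → X} (hι : IsSemiIsometricHypersurface g θ ι) (p : M) :
    ∃ (U : Set (VV n)) (Ω : Set (EE n)), base n p ∈ U ∧ (localData g θ ι p).IsGood U Ω := by
  have := isManifold_real_of_complex n X
  obtain ⟨hcont, hdiff⟩ := contMDiff_iff.mp hι.smooth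
  -- The coordinate region that ι sends into the chart at ι p; U is an open neighbourhood inside it
  -- on which the local equations hold.
  set W : Set (VV n) := (extChartAt 𝓘(ℝ, VV n) p).target ∩
    (extChartAt 𝓘(ℝ, VV n) p).symm ⁻¹' (ι ⁻¹' (extChartAt 𝓘(ℝ, EE n) (ι p)).source) with hW
  have hWo : IsOpen W := (continuousOn_extChartAt_symm p).isOpen_inter_preimage
    (isOpen_extChartAt_target p) ((isOpen_extChartAt_source (ι p)).preimage hcont)
  have hpW : base n p ∈ W := by
    refine ⟨mem_extChartAt_target p, ?_⟩
    simp only [Set.mem_preimage, base, extChartAt_to_inv]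
    exact mem_extChartAt_source (ι p)
  obtain ⟨U, hU, hUo, hpU⟩ := mem_nhds_iff.mp
    (Filter.inter_mem (hι.local_eqs p) (hWo.mem_nhds hpW))
  refine ⟨U, (extChartAt 𝓘(ℂ, EE n) (ι p)).target, hpU, ?_⟩
  exact
    { metric := g.isKahlerOn_inChart (ι p)
      isOpen := hUo
      maps := fun u hu => (extChartAt 𝓘(ℂ, EE n) (ι p)).map_source (hU hu).2.2
      smooth := fun u hu => (hdiff p (ι p)).contDiffAt (hWo.mem_nhds (hU hu).2)
      theta_add := fun u v w => (congrArg (θ.form _) (map_add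
        (mfderiv 𝓘(ℝ, VV n) 𝓘(ℝ, VV n) (extChartAt 𝓘(ℝ, VV n) p).symm u) v w)).trans (map_add _ _ _)
      theta_smul := fun u c v => (congrArg (θ.form _) (map_smul
        (mfderiv 𝓘(ℝ, VV n) 𝓘(ℝ, VV n) (extChartAt 𝓘(ℝ, VV n) p).symm u) c v)).trans (map_smul _ _ _)
      theta_smooth := fun u hu v =>
        (θ.smooth p v).contDiffAt ((isOpen_extChartAt_target p).mem_nhds (hU hu).2.1)
      semi := fun u hu => (hU hu).1 }

end Charts

end SemiIsometric

open SemiIsometric in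
theorem proposition2p2 (n : ℕ)
    {X : Type*} [TopologicalSpace X] [ChartedSpace (SemiIsometric.EE n) X]
    [IsManifold 𝓘(ℂ, SemiIsometric.EE n) ∞ X]
    {M : Type*} [TopologicalSpace M] [ChartedSpace (SemiIsometric.VV n) M]
    [IsManifold 𝓘(ℝ, SemiIsometric.VV n) ∞ M]
    (g : SemiIsometric.KahlerMetric n X) (θ : SemiIsometric.OneForm n M) (ι : M → X)
    (hι : SemiIsometric.IsSemiIsometricHypersurface g θ ι) :
    (∀ (p : M) (z : SemiIsometric.VC n), SemiIsometric.T10 g θ ι p z → z ≠ 0 →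
      0 < SemiIsometric.meanCurvSq g θ ι p ∧
      SemiIsometric.holSec g θ ι p z
          + ((1 / 2 * (‖SemiIsometric.holTor g θ ι p z‖ ^ 2
              / SemiIsometric.meanCurvSq g θ ι p) : ℝ) : ℂ)
        = 1 / 2 * SemiIsometric.ambientHolSec g θ ι p z
          + ((SemiIsometric.meanCurvSq g θ ι p : ℝ) : ℂ)) ∧
    (SemiIsometric.VanishingTorsion g θ ι ↔ SemiIsometric.TotallyUmbilical g θ ι) ∧
    (SemiIsometric.VanishingTorsion g θ ι →
      ∀ (p : M) (z : SemiIsometric.VC n), SemiIsometric.T10 g θ ι p z → z ≠ 0 →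
        SemiIsometric.holSec g θ ι p z
          = 1 / 2 * SemiIsometric.ambientHolSec g θ ι p z
            + ((SemiIsometric.meanCurvSq g θ ι p : ℝ) : ℂ)) := by
  have hmain : ∀ (p : M) (z : VC n), T10 g θ ι p z → z ≠ 0 → 0 < meanCurvSq g θ ι p ∧
      holSec g θ ι p z + ((1 / 2 * (‖holTor g θ ι p z‖ ^ 2 / meanCurvSq g θ ι p) : ℝ) : ℂ)
        = 1 / 2 * ambientHolSec g θ ι p z + ((meanCurvSq g θ ι p : ℝ) : ℂ) := by
    intro p z hz h0
    obtain ⟨U, Ω, hp, hd⟩ := hι.exists_isGood p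
    exact ⟨hd.meanCurvSq_pos hp (hd.dim_ne_zero hp hz h0), hd.holSec_add_holTor hp hz h0⟩
  -- Vanishing torsion and umbilicity are equivalent at each point separately.
  refine ⟨hmain, forall_congr' fun p => ?_, fun hτ p z hz h0 => ?_⟩
  · obtain ⟨U, Ω, hp, hd⟩ := hι.exists_isGood p
    exact hd.tauAt_eq_zero_iff hp
  · obtain ⟨U, Ω, hp, hd⟩ := hι.exists_isGood p
    have htor : holTor g θ ι p z = 0 := by
      rw [SemiIsometric.holTor, LocalData.holTor, hτ p z hz, conjVec_zero,
        hd.levi_eq hp _ (hd.isT10_zero hp), LocalData.push_zero, hd.metric.zero_right, mul_zero,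
        zero_div]
    simpa [htor] using (hmain p z hz h0).2
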